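/- **Model.** The state $\theta\in\{0,1\}$ has equal prior probabilities. Given $\theta$, agents $n=1,2,\dots$ receive i.i.d. private signals $s_n\in(-1,1)$ with density $f_\theta$, where $f_0,f_1$ are continuous and strictly positive on $(-1,1)$, $f_1/f_0$ is strictly increasing, and $f_1(s)=f_0(-s)$. Agents move in order. Agent $n$, after receiving $s_n$, either does not observe (chooses $\varnothing$) or pays a cost $c$ and observes the actions of the agents in a set $B(n)\subset\{1,\dots,n-1\}$ of her choice with $|B(n)|\le K(n)$; the actions in $B(n)$ are observed simultaneously. Then she chooses $a_n\in\{0,1\}$ and gets payoff $1$ if $a_n=\theta$ and $0$ otherwise, minus $c$ if she observed. The capacities $K(n)\in\mathbb N$ are positive for all but finitely many $n$. A (pure) strategy of $n$ consists of a map $\sigma_n^1$ from signals to neighborhoods and a map $\sigma_n^2$ from information sets (signal, chosen neighborhood, observed actions) to actions, both measurable in the signal. A *symmetric equilibrium* is a pure strategy perfect Bayesian equilibrium $\sigma$ (for every $n$, $\sigma^2_n$ maximizes the expected payoff at every information set, and $\sigma^1_n(s_n)$ maximizes it for every signal $s_n$ given $\sigma_n^2$, the strategies of the other agents being given) with $\sigma^1_n(s)=\sigma^1_n(-s)$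 for all $n$ and all $s\in[0,1)$. **Definitions.** Private beliefs are *strong* if there are $s^*,s_*\in(-1,1)$ with $\frac{f_1(s^*)}{f_0(s^*)+f_1(s^*)}=1-c$ and $\frac{f_0(s_*)}{f_0(s_*)+f_1(s_*)}=1-c$. Let $P^*(c)$ be the probability of a correct action of a hypothetical agent who, after receiving her private signal, can pay $c$ to learn $\theta$, does so exactly if this is strictly better than acting on her signal alone, and acts optimally. *Maximal learning* occurs in $\sigma$ if $\lim_{n\to\infty}\mathcal P_\sigma(a_n=\theta)=P^*(c)$. The capacity structure has *infinite observations* if $\lim_{n\to\infty}K(n)=\infty$. **Theorem 2.** Let $0<c<\frac12$ and suppose that private beliefs are strong. Then maximal learning occurs in every symmetric equilibrium if and only if the capacity structure has infinite observations. -/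

import Mathlib

open MeasureTheory Filter Topology

noncomputable section

namespace CostlyLearning

/-- The signal space: the open interval from `-1` to `1`. -/
def signalSpace : Set ℝ := Set.Ioo (-1) 1

/-- A signal structure: `f θ` is the density of a private signal in state `θ ∈ {0, 1}`.
Only the values on the signal space matter. -/
structure SignalStructure where
  f : Fin 2 → ℝ → ℝ
  continuousOn_f : ∀ θ, ContinuousOn (f θ) signalSpace
  f_pos : ∀ θ, ∀ s ∈ signalSpace, 0 < f θ s
  integral_f : ∀ θ, ∫ s in signalSpace, f θ s = 1
  /-- Monotone likelihood ratio property. -/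
  mlrp : StrictMonoOn (fun s => f 1 s / f 0 s) signalSpace
  /-- The signal structure is symmetric. -/
  symm : ∀ s ∈ signalSpace, f 1 s = f 0 (-s)

namespace SignalStructure

variable (S : SignalStructure)

/-- The law of one private signal in state `θ`. -/
def signalLaw (θ : Fin 2) : Measure ℝ :=
  (volume.restrict signalSpace).withDensity (fun s => ENNReal.ofReal (S.f θ s))

instance isProbabilityMeasure_signalLaw (θ : Fin 2) :
    IsProbabilityMeasure (S.signalLaw θ) := by
  refine ⟨?_⟩
  have hint : Integrable (S.f θ) (volume.restrict signalSpace) := by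
    by_contra h
    have h1 := S.integral_f θ
    rw [integral_undef h] at h1
    exact zero_ne_one h1
  have hnn : 0 ≤ᵐ[volume.restrict signalSpace] S.f θ := by
    have hm : MeasurableSet signalSpace := measurableSet_Ioo
    filter_upwards [ae_restrict_mem hm] with s hs
    exact (S.f_pos θ s hs).le
  rw [signalLaw, withDensity_apply _ MeasurableSet.univ, Measure.restrict_univ,
    ← ofReal_integral_eq_lintegral_ofReal hint hnn, S.integral_f θ, ENNReal.ofReal_one]

/-- The law of the whole sequence of private signals in state `θ`: the signals are i.i.d. -/
def signalsLaw (θ : Fin 2) : Measure (ℕ → ℝ) :=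
  Measure.infinitePi (fun _ : ℕ => S.signalLaw θ)

/-- The joint law of the state, which is uniform on `{0, 1}`, and of all private signals. -/
def jointLaw : Measure (Fin 2 × (ℕ → ℝ)) :=
  ∑ θ : Fin 2, (2⁻¹ : ENNReal) • (Measure.dirac θ).prod (S.signalsLaw θ)

/-- The conditional probability of state `θ` given the private signal `s` alone. -/
def belief (θ : Fin 2) (s : ℝ) : ℝ :=
  S.f θ s / (S.f 0 s + S.f 1 s)

/-- Strong private beliefs (relative to the cost `c`): at some signal in each direction an agent
is indifferent between paying `c` to learn the state and acting on her signal alone. -/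
def StrongPrivateBeliefs (c : ℝ) : Prop :=
  (∃ s ∈ signalSpace, S.belief 1 s = 1 - c) ∧ (∃ s ∈ signalSpace, S.belief 0 s = 1 - c)

/-- `P*(c)`: the probability of a correct action of a hypothetical agent who can pay `c` to learn
the true state. With signal `s` she is correct with probability `max (belief 0 s) (belief 1 s)` if
she does not pay, so she pays exactly when `1 - c` exceeds this number, and then she is correct
for sure. The signal has the unconditional density `(f 0 + f 1) / 2`. -/
def benchmark (c : ℝ) : ℝ :=
  ∫ s in signalSpace, (S.f 0 s + S.f 1 s) / 2 *
    (if max (S.belief 0 s) (S.belief 1 s) < 1 - c then 1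
      else max (S.belief 0 s) (S.belief 1 s))

end SignalStructure

/-- The capacity structure `K` has infinite observations. -/
def InfiniteObservations (K : ℕ → ℕ) : Prop :=
  Tendsto K atTop atTop

/-- The neighborhoods that agent `n` may choose: sets of at most `K n` predecessors. The agents are
numbered `0, 1, 2, …`, so the predecessors of agent `n` are the elements of `Finset.range n`. -/
def Feasible (K : ℕ → ℕ) (n : ℕ) (B : Finset ℕ) : Prop :=
  B ⊆ Finset.range n ∧ B.card ≤ K n

/-- A profile of pure strategies. `nbhd n s` is the neighborhood chosen by agent `n` with signal
`s`, where `∅` means that she does not pay and does not observe. `act n s B h` is her action if her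
signal is `s` and she has observed the actions `h` in the neighborhood `B`. -/
structure StrategyProfile (K : ℕ → ℕ) where
  nbhd : ℕ → ℝ → Finset ℕ
  act : ℕ → ℝ → (B : Finset ℕ) → (B → Fin 2) → Fin 2
  feasible : ∀ n s, Feasible K n (nbhd n s)
  measurableSet_nbhd : ∀ n B, MeasurableSet {s | nbhd n s = B}
  measurable_act : ∀ n B h, Measurable (fun s => act n s B h)

namespace StrategyProfile

variable {K : ℕ → ℕ} (σ : StrategyProfile K)

/-- The action of agent `n` when all agents follow `σ` and `x` is the sequence of signals. -/
def action (x : ℕ → ℝ) (n : ℕ) : Fin 2 :=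
  σ.act n (x n) (σ.nbhd n (x n)) (fun m => action x m.1)
termination_by n
decreasing_by exact Finset.mem_range.mp ((σ.feasible n (x n)).1 m.2)

variable (S : SignalStructure)

/-- The probability that the actions in `B` are `h`, given the state `θ`. -/
def historyProb (θ : Fin 2) (B : Finset ℕ) (h : B → Fin 2) : ℝ :=
  (S.signalsLaw θ).real {x | ∀ m : B, σ.action x m.1 = h m}

/-- The posterior probability of the state `θ` for an agent with signal `s` who observes the actions
`h` in a set `B` of her predecessors (Bayes' rule; given the state, her own signal is independent of
the actions of her predecessors). -/
def posterior (s : ℝ) (B : Finset ℕ) (h : B → Fin 2) (θ : Fin 2) : ℝ :=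
  S.f θ s * σ.historyProb S θ B h /
    (S.f 0 s * σ.historyProb S 0 B h + S.f 1 s * σ.historyProb S 1 B h)

/-- The expected payoff of agent `n`, given her signal `s`, from choosing the neighborhood `B` and
then following `σ.act`: the probability that her action matches the state, minus the cost `c` if she
observes. -/
def expectedPayoff (c : ℝ) (n : ℕ) (s : ℝ) (B : Finset ℕ) : ℝ :=
  (∑ θ : Fin 2, S.belief θ s *
      (S.signalsLaw θ).real {x | σ.act n s B (fun m => σ.action x m.1) = θ})
    - (if B = ∅ then 0 else c)

/-- Pure strategy perfect Bayesian equilibrium. The payoff of an action `y` is the probability that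
`y` is the state, so at each information set the chosen action must have the largest posterior;
and at each signal the chosen neighborhood must have the largest expected payoff. -/
structure IsPerfectBayesian (c : ℝ) : Prop where
  act_optimal : ∀ n, ∀ s ∈ signalSpace, ∀ B, Feasible K n B → ∀ h : B → Fin 2, ∀ y : Fin 2,
    σ.posterior S s B h y ≤ σ.posterior S s B h (σ.act n s B h)
  nbhd_optimal : ∀ n, ∀ s ∈ signalSpace, ∀ B, Feasible K n B →
    σ.expectedPayoff S c n s B ≤ σ.expectedPayoff S c n s (σ.nbhd n s)

/-- A profile is symmetric if the neighborhoods chosen at the signals `s` and `-s` coincide. -/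
def IsSymmetric : Prop :=
  ∀ n, ∀ s ∈ Set.Ico (0 : ℝ) 1, σ.nbhd n s = σ.nbhd n (-s)

/-- Pure strategy symmetric perfect Bayesian equilibrium. -/
def IsSymmetricEquilibrium (c : ℝ) : Prop :=
  σ.IsPerfectBayesian S c ∧ σ.IsSymmetric

/-- The probability that the action of agent `n` matches the state. -/
def learningProb (n : ℕ) : ℝ :=
  S.jointLaw.real {ω | σ.action ω.2 n = ω.1}

/-- Maximal learning (relative to the cost `c`). -/
def MaximalLearning (c : ℝ) : Prop :=
  Tendsto (fun n => σ.learningProb S n) atTop (𝓝 (S.benchmark c))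

end StrategyProfile

end CostlyLearning

end

/-! Given her signal, a correct action has probability `1 - bayesError` in equilibrium, and
`learningProb` averages this over signals. An agent with a belief above `1 - c` does not observe and
matches the benchmark exactly, so everything hinges on the intermediate signals, where the benchmark
agent is always right.

Sufficiency. Agent `n` may observe the first `min (K n) n` agents. Each of their actions is
informative: by symmetry of neighborhoods and of the densities, the probability of action `1`
differs between the states by at least a fixed `δ > 0`, whatever the earlier actions
(`exists_informative`). Hence the Bhattacharyya coefficient of the two laws of the first `k` actions
decays geometrically (`sum_sqrt_fullProb_le`), and it bounds the Bayes error. So at intermediate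
signals observing eventually beats not observing and the error vanishes; dominated convergence
concludes (`maximalLearning`).

Necessity. If `K n < M` for infinitely many `n`, extreme signals of the observed agents produce any
given history with probability at least `ε ^ M` in both states (`pow_le_historyProb`). The error at
intermediate signals is then bounded below, and `learningProb` stays a fixed distance below the
benchmark infinitely often (`not_maximalLearning`). To contradict the left side, a symmetric
equilibrium must exist: one is built by recursive best responses with antisymmetric tie-breaking
(`isSymmetricEquilibrium_equilibrium`). -/

open ProbabilityTheory

namespace CostlyLearning

/-! ### Signal laws and independence of the own signal from the past. -/

namespace SignalStructure
variable (S : SignalStructure)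

lemma measurableSet_signalSpace : MeasurableSet signalSpace := measurableSet_Ioo

lemma belief_pos (θ : Fin 2) {s : ℝ} (hs : s ∈ signalSpace) : 0 < S.belief θ s :=
  div_pos (S.f_pos θ s hs) (add_pos (S.f_pos 0 s hs) (S.f_pos 1 s hs))

lemma belief_add {s : ℝ} (hs : s ∈ signalSpace) : S.belief 0 s + S.belief 1 s = 1 := by
  have := add_pos (S.f_pos 0 s hs) (S.f_pos 1 s hs)
  rw [belief, belief, ← add_div, div_self this.ne']

lemma mass_mul_belief (θ : Fin 2) {s : ℝ} (hs : s ∈ signalSpace) :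
    (S.f 0 s + S.f 1 s) * S.belief θ s = S.f θ s := by
  have := add_pos (S.f_pos 0 s hs) (S.f_pos 1 s hs)
  rw [belief, mul_div_cancel₀ _ this.ne']

lemma integrableOn_f (θ : Fin 2) : IntegrableOn (S.f θ) signalSpace := by
  by_contra h
  have h1 := S.integral_f θ
  rw [integral_undef h] at h1
  exact zero_ne_one h1

lemma measurable_indicator_f (θ : Fin 2) : Measurable (signalSpace.indicator (S.f θ)) := by
  classical
  rw [← Set.piecewise_eq_indicator]
  exact (S.continuousOn_f θ).measurable_piecewise continuousOn_const measurableSet_signalSpace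

lemma integral_signalLaw (θ : Fin 2) (g : ℝ → ℝ) :
    ∫ s, g s ∂S.signalLaw θ = ∫ s in signalSpace, S.f θ s * g s := by
  rw [signalLaw, integral_withDensity_eq_integral_toReal_smul₀]
  · refine setIntegral_congr_fun measurableSet_signalSpace fun s hs => ?_
    simp [ENNReal.toReal_ofReal (S.f_pos θ s hs).le]
  · exact (S.integrableOn_f θ).aestronglyMeasurable.aemeasurable.ennreal_ofReal
  · simp

lemma signalLaw_real (θ : Fin 2) {A : Set ℝ} (hA : MeasurableSet A) :
    (S.signalLaw θ).real A = ∫ s in signalSpace, S.f θ s * A.indicator 1 s := by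
  rw [← integral_signalLaw, integral_indicator_one hA]

instance isProbabilityMeasure_signalsLaw (θ : Fin 2) : IsProbabilityMeasure (S.signalsLaw θ) := by
  unfold signalsLaw; infer_instance

lemma map_eval_signalsLaw (θ : Fin 2) (n : ℕ) :
    (S.signalsLaw θ).map (fun x => x n) = S.signalLaw θ :=
  (measurePreserving_eval_infinitePi (fun _ : ℕ => S.signalLaw θ) n).map_eq

end SignalStructure

/-- Replace all signals from the `n`-th on by `0`. -/
def truncate (n : ℕ) (x : ℕ → ℝ) : ℕ → ℝ := fun m => if m < n then x m else 0

lemma measurable_truncate (n : ℕ) : Measurable (truncate n) := by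
  refine measurable_pi_lambda _ fun m => ?_
  unfold truncate
  split_ifs
  · exact measurable_pi_apply m
  · exact measurable_const

lemma SignalStructure.indepFun_eval_truncate (S : SignalStructure) (θ : Fin 2) (n : ℕ) :
    IndepFun (fun x : ℕ → ℝ => x n) (truncate n) (S.signalsLaw θ) := by
  have h : iIndepFun (fun (m : ℕ) (x : ℕ → ℝ) => x m) (S.signalsLaw θ) :=
    iIndepFun_infinitePi (P := fun _ : ℕ => S.signalLaw θ) (X := fun _ s => s)
      (fun _ => measurable_id)
  have h2 := h.indepFun_finset {n} (Finset.range n) (by simp) (fun m => measurable_pi_apply m)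
  -- The two maps factor through disjoint blocks of coordinates.
  let φ : (({n} : Finset ℕ) → ℝ) → ℝ := fun y => y ⟨n, by simp⟩
  let ψ : ((Finset.range n) → ℝ) → ℕ → ℝ :=
    fun y m => if hm : m < n then y ⟨m, Finset.mem_range.mpr hm⟩ else 0
  have hψ : Measurable ψ := by
    refine measurable_pi_lambda _ fun m => ?_
    by_cases hm : m < n
    · simp only [ψ, hm, dite_true]; exact measurable_pi_apply _
    · simp only [ψ, hm, dite_false]; exact measurable_const
  have hφ : Measurable φ := measurable_pi_apply _
  have h3 := h2.comp hφ hψ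
  convert h3 using 1
  · rfl
  · funext x m
    simp [truncate, ψ]

/-- The signal of agent `n` can be integrated out separately from those of her predecessors. -/
lemma SignalStructure.signalsLaw_eval_truncate (S : SignalStructure) (θ : Fin 2) (n : ℕ)
    {E : Set (ℝ × (ℕ → ℝ))} (hE : MeasurableSet E) :
    (S.signalsLaw θ).real {x | (x n, truncate n x) ∈ E} =
      ∫ s, (S.signalsLaw θ).real {x | (s, truncate n x) ∈ E} ∂S.signalLaw θ := by
  have hm : Measurable fun x : ℕ → ℝ => (x n, truncate n x) :=
    (measurable_pi_apply n).prodMk (measurable_truncate n)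
  have h := (indepFun_iff_map_prod_eq_prod_map_map (measurable_pi_apply n).aemeasurable
    (measurable_truncate n).aemeasurable).mp (S.indepFun_eval_truncate θ n)
  rw [S.map_eval_signalsLaw] at h
  have : IsProbabilityMeasure ((S.signalsLaw θ).map (truncate n)) :=
    Measure.isProbabilityMeasure_map (measurable_truncate n).aemeasurable
  have h1 : (S.signalsLaw θ) {x | (x n, truncate n x) ∈ E} =
      ∫⁻ s, (S.signalsLaw θ) {x | (s, truncate n x) ∈ E} ∂S.signalLaw θ := by
    have := Measure.map_apply (μ := S.signalsLaw θ) hm hE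
    rw [Set.preimage] at this
    rw [← this, h, Measure.prod_apply hE]
    refine lintegral_congr fun s => ?_
    rw [Measure.map_apply (measurable_truncate n) (measurable_prodMk_left hE)]
    rfl
  have h2 : ∀ s, (S.signalsLaw θ) {x | (s, truncate n x) ∈ E} =
      ((S.signalsLaw θ).map (truncate n)) (Prod.mk s ⁻¹' E) := fun s => by
    rw [Measure.map_apply (measurable_truncate n) (measurable_prodMk_left hE)]
    rfl
  rw [Measure.real, h1]
  simp only [Measure.real]
  rw [integral_toReal]
  · simp_rw [h2]
    exact (measurable_measure_prodMk_left hE).aemeasurable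
  · exact Eventually.of_forall fun s => measure_lt_top _ _

/-! ### Actions, their measurability, and the probability of a correct action. -/

namespace StrategyProfile

variable {K : ℕ → ℕ} (σ τ : StrategyProfile K)

lemma lt_of_mem_nbhd {n : ℕ} {s : ℝ} (m : σ.nbhd n s) : m.1 < n :=
  Finset.mem_range.mp ((σ.feasible n s).1 m.2)

lemma action_eq (x : ℕ → ℝ) (n : ℕ) :
    σ.action x n = σ.act n (x n) (σ.nbhd n (x n)) (fun m => σ.action x m.1) := by
  rw [action]

variable {σ τ} in
-- Only agents up to `n` matter for the action of `n`. Changing the signals gives `action_truncate`;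
-- changing the profile is needed for the recursive construction of an equilibrium.
lemma action_congr {x y : ℕ → ℝ} {n : ℕ} (hxy : ∀ m ≤ n, x m = y m)
    (hn : ∀ m ≤ n, σ.nbhd m = τ.nbhd m) (ha : ∀ m ≤ n, σ.act m = τ.act m) :
    σ.action x n = τ.action y n := by
  induction n using Nat.strong_induction_on with
  | _ n ih =>
    rw [action_eq, action_eq, ← hxy n le_rfl, ← hn n le_rfl, ← ha n le_rfl]
    congr 1
    funext m
    have hm := σ.lt_of_mem_nbhd m
    exact ih m.1 hm (fun k hk => hxy k (hk.trans hm.le)) (fun k hk => hn k (hk.trans hm.le))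
      (fun k hk => ha k (hk.trans hm.le))

lemma action_truncate (x : ℕ → ℝ) {m n : ℕ} (hm : m < n) :
    σ.action (truncate n x) m = σ.action x m :=
  action_congr (fun k hk => by simp [truncate, hk.trans_lt hm]) (fun _ _ => rfl) (fun _ _ => rfl)

/-- Split according to the countably many neighborhoods and observed histories. The signal `u` and
the observed actions `a` are kept general to cover random histories as well as the frozen ones in
`responseSet`. -/
lemma measurable_act_nbhd (n : ℕ) {α : Type*} [MeasurableSpace α] (u : α → ℝ) (hu : Measurable u)
    (a : α → ℕ → Fin 2) (ha : ∀ m < n, Measurable fun z => a z m) :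
    Measurable fun z => σ.act n (u z) (σ.nbhd n (u z)) (fun m => a z m.1) := by
  refine measurable_to_countable' fun y => ?_
  have : (fun z => σ.act n (u z) (σ.nbhd n (u z)) (fun m => a z m.1)) ⁻¹' {y} =
      ⋃ B : Finset ℕ, ⋃ _ : B ⊆ Finset.range n, ⋃ h : B → Fin 2,
        u ⁻¹' {s | σ.nbhd n s = B} ∩ ((⋂ m : B, {z | a z m.1 = h m}) ∩
          (fun z => σ.act n (u z) B h) ⁻¹' {y}) := by
    ext z
    simp only [Set.mem_preimage, Set.mem_singleton_iff, Set.mem_iUnion, Set.mem_inter_iff,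
      Set.mem_ofPred_eq, Set.mem_iInter]
    constructor
    · intro h
      exact ⟨_, (σ.feasible n (u z)).1, _, rfl, fun m => rfl, h⟩
    · rintro ⟨B, hB, h, hb, hm, h3⟩
      subst hb
      rw [← h3]
      congr 1
      funext m
      exact hm m
  rw [this]
  refine .iUnion fun B => .iUnion fun hB => .iUnion fun h =>
    (hu (σ.measurableSet_nbhd n B)).inter (.inter (.iInter fun m => ?_) ?_)
  · exact ha m.1 (Finset.mem_range.mp (hB m.2)) (measurableSet_singleton _)
  · exact ((σ.measurable_act n B h).comp hu) (measurableSet_singleton y)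

lemma measurable_action (n : ℕ) : Measurable fun x => σ.action x n := by
  induction n using Nat.strong_induction_on with
  | _ n ih =>
    have := σ.measurable_act_nbhd n (fun x : ℕ → ℝ => x n) (measurable_pi_apply n)
      (fun x m => σ.action x m) ih
    convert this using 2 with x
    exact σ.action_eq x n

variable (S : SignalStructure)

/-- The probability, given the signal `s`, that agent `n` acts correctly after observing `B`. -/
noncomputable def correctProb (n : ℕ) (s : ℝ) (B : Finset ℕ) : ℝ :=
  ∑ θ : Fin 2, S.belief θ s *
    (S.signalsLaw θ).real {x | σ.act n s B (fun m => σ.action x m.1) = θ}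

lemma expectedPayoff_eq (c : ℝ) (n : ℕ) (s : ℝ) (B : Finset ℕ) :
    σ.expectedPayoff S c n s B = σ.correctProb S n s B - if B = ∅ then 0 else c := rfl

lemma measurable_act_nbhd_truncate (n : ℕ) :
    Measurable fun z : ℝ × (ℕ → ℝ) =>
      σ.act n z.1 (σ.nbhd n z.1) (fun m => σ.action (truncate n z.2) m.1) :=
  σ.measurable_act_nbhd n _ measurable_fst (fun z m => σ.action (truncate n z.2) m)
      fun m _ => (σ.measurable_action m).comp ((measurable_truncate n).comp measurable_snd)

lemma setOf_act_truncate (n : ℕ) (s : ℝ) (θ : Fin 2) :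
    {x : ℕ → ℝ | σ.act n s (σ.nbhd n s) (fun m => σ.action (truncate n x) m.1) = θ} =
      {x | σ.act n s (σ.nbhd n s) (fun m => σ.action x m.1) = θ} := by
  ext x
  simp only [Set.mem_ofPred_eq]
  have : (fun m : σ.nbhd n s => σ.action (truncate n x) m.1) = fun m => σ.action x m.1 :=
    funext fun m => σ.action_truncate x (σ.lt_of_mem_nbhd m)
  rw [this]

lemma truncate_truncate (n : ℕ) (x : ℕ → ℝ) : truncate n (truncate n x) = truncate n x := by
  funext m; simp only [truncate]; split_ifs <;> rfl

lemma measurable_condProb (n : ℕ) (θ : Fin 2) :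
    Measurable fun s => (S.signalsLaw θ).real
      {x | σ.act n s (σ.nbhd n s) (fun m => σ.action x m.1) = θ} := by
  have h := measurable_measure_prodMk_left (ν := S.signalsLaw θ)
    (σ.measurable_act_nbhd_truncate n (measurableSet_singleton θ))
  convert h.ennreal_toReal using 2 with s
  rw [← setOf_act_truncate]
  rfl

lemma action_prob (n : ℕ) (θ : Fin 2) :
    (S.signalsLaw θ).real {x | σ.action x n = θ} = ∫ s, (S.signalsLaw θ).real
      {x | σ.act n s (σ.nbhd n s) (fun m => σ.action x m.1) = θ} ∂S.signalLaw θ := by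
  have := S.signalsLaw_eval_truncate θ n
    (σ.measurable_act_nbhd_truncate n (measurableSet_singleton θ))
  simp only [Set.mem_preimage, Set.mem_singleton_iff, setOf_act_truncate,
    truncate_truncate] at this
  rw [← this]
  congr 1
  ext x
  simp only [Set.mem_ofPred_eq]
  rw [action_eq]
  have : (fun m : σ.nbhd n (x n) => σ.action (truncate n x) m.1) = fun m => σ.action x m.1 :=
    funext fun m => σ.action_truncate x (σ.lt_of_mem_nbhd m)
  rw [this]

lemma learningProb_eq_sum (n : ℕ) :
    σ.learningProb S n = ∑ θ : Fin 2, 2⁻¹ * (S.signalsLaw θ).real {x | σ.action x n = θ} := by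
  have hE : MeasurableSet {ω : Fin 2 × (ℕ → ℝ) | σ.action ω.2 n = ω.1} :=
    measurableSet_eq_fun ((σ.measurable_action n).comp measurable_snd) measurable_fst
  rw [learningProb, SignalStructure.jointLaw, Measure.real, Measure.finsetSum_apply,
    ENNReal.toReal_sum]
  · refine Finset.sum_congr rfl fun θ _ => ?_
    rw [Measure.smul_apply, smul_eq_mul, ENNReal.toReal_mul, Measure.dirac_prod,
      Measure.map_apply measurable_prodMk_left hE]
    simp [Measure.real]
  · intro θ _
    rw [Measure.smul_apply, smul_eq_mul]
    exact ENNReal.mul_ne_top (by simp) (measure_ne_top _ _)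

lemma condProb_integrable (n : ℕ) (θ : Fin 2) :
    IntegrableOn (fun s => S.f θ s * (S.signalsLaw θ).real
      {x | σ.act n s (σ.nbhd n s) (fun m => σ.action x m.1) = θ}) signalSpace := by
  refine (S.integrableOn_f θ).mul_bdd (c := 1) (σ.measurable_condProb S n θ).aestronglyMeasurable
    (Eventually.of_forall fun s => ?_)
  rw [Real.norm_of_nonneg measureReal_nonneg]
  exact measureReal_le_one

/-- The unconditional probability of a correct action averages the conditional one over signals. -/
lemma learningProb_eq_integral (n : ℕ) :
    IntegrableOn (fun s => (S.f 0 s + S.f 1 s) / 2 * σ.correctProb S n s (σ.nbhd n s))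
      signalSpace ∧
    σ.learningProb S n = ∫ s in signalSpace,
      (S.f 0 s + S.f 1 s) / 2 * σ.correctProb S n s (σ.nbhd n s) := by
  have key : ∀ s ∈ signalSpace, 2⁻¹ * (S.f 0 s * (S.signalsLaw 0).real
      {x | σ.act n s (σ.nbhd n s) (fun m => σ.action x m.1) = 0}) + 2⁻¹ * (S.f 1 s *
      (S.signalsLaw 1).real {x | σ.act n s (σ.nbhd n s) (fun m => σ.action x m.1) = 1}) =
      (S.f 0 s + S.f 1 s) / 2 * σ.correctProb S n s (σ.nbhd n s) := by
    intro s hs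
    rw [correctProb, Fin.sum_univ_two]
    linear_combination (-(2⁻¹ * (S.signalsLaw 0).real
      {x | σ.act n s (σ.nbhd n s) (fun m => σ.action x m.1) = 0})) * S.mass_mul_belief 0 hs -
      2⁻¹ * (S.signalsLaw 1).real {x | σ.act n s (σ.nbhd n s) (fun m => σ.action x m.1) = 1} *
        S.mass_mul_belief 1 hs
  have h0 := (σ.condProb_integrable S n 0).const_mul 2⁻¹
  have h1 := (σ.condProb_integrable S n 1).const_mul 2⁻¹
  refine ⟨(h0.add h1).congr ?_, ?_⟩
  · filter_upwards [ae_restrict_mem SignalStructure.measurableSet_signalSpace] with s hs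
    exact key s hs
  · rw [← setIntegral_congr_fun SignalStructure.measurableSet_signalSpace key,
      learningProb_eq_sum, Fin.sum_univ_two, action_prob, action_prob,
      SignalStructure.integral_signalLaw, SignalStructure.integral_signalLaw,
      integral_add h0 h1, integral_const_mul, integral_const_mul]

end StrategyProfile
-- Reflection of signals, and the benchmark.
namespace SignalStructure
variable (S : SignalStructure)

lemma belief_le_one (θ : Fin 2) {s : ℝ} (hs : s ∈ signalSpace) : S.belief θ s ≤ 1 := by
  have h0 := S.belief_pos 0 hs
  have h1 := S.belief_pos 1 hs
  have := S.belief_add hs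
  fin_cases θ <;> simp <;> linarith

lemma neg_mem_signalSpace {s : ℝ} (hs : s ∈ signalSpace) : -s ∈ signalSpace :=
  ⟨neg_lt_neg hs.2, by linarith [hs.1]⟩

lemma f_zero_eq {s : ℝ} (hs : s ∈ signalSpace) : S.f 0 s = S.f 1 (-s) := by
  rw [S.symm _ (neg_mem_signalSpace hs), neg_neg]

lemma belief_one_neg {s : ℝ} (hs : s ∈ signalSpace) : S.belief 1 (-s) = S.belief 0 s := by
  rw [belief, belief, ← S.f_zero_eq hs, ← S.symm s hs, add_comm]

lemma belief_zero_neg {s : ℝ} (hs : s ∈ signalSpace) : S.belief 0 (-s) = S.belief 1 s := by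
  rw [belief, belief, ← S.f_zero_eq hs, ← S.symm s hs, add_comm]

lemma strictMonoOn_belief_one : StrictMonoOn (S.belief 1) signalSpace := by
  intro s hs t ht hst
  have h := S.mlrp hs ht hst
  simp only at h
  rw [div_lt_div_iff₀ (S.f_pos 0 s hs) (S.f_pos 0 t ht)] at h
  rw [belief, belief, div_lt_div_iff₀ (add_pos (S.f_pos 0 s hs) (S.f_pos 1 s hs))
    (add_pos (S.f_pos 0 t ht) (S.f_pos 1 t ht))]
  linarith

/-- Compare the beliefs at `-s` and `s`: reflection exchanges the two states. -/
lemma f_lt_of_pos {s : ℝ} (hs : s ∈ signalSpace) (h0 : 0 < s) : S.f 0 s < S.f 1 s := by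
  have h := S.strictMonoOn_belief_one (neg_mem_signalSpace hs) hs (by linarith)
  rw [S.belief_one_neg hs] at h
  have := mul_lt_mul_of_pos_left h (add_pos (S.f_pos 0 s hs) (S.f_pos 1 s hs))
  rwa [S.mass_mul_belief 0 hs, S.mass_mul_belief 1 hs] at this

lemma integrableOn_mass_mul {g : ℝ → ℝ} {C : ℝ}
    (hg : AEStronglyMeasurable g (volume.restrict signalSpace)) (hC : ∀ s, |g s| ≤ C) :
    IntegrableOn (fun s => (S.f 0 s + S.f 1 s) / 2 * g s) signalSpace := by
  exact (((S.integrableOn_f 0).add (S.integrableOn_f 1)).div_const 2).mul_bdd (c := C) hg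
    (Eventually.of_forall hC)

lemma continuousOn_belief (θ : Fin 2) : ContinuousOn (S.belief θ) signalSpace :=
  (S.continuousOn_f θ).div ((S.continuousOn_f 0).add (S.continuousOn_f 1))
    fun s hs => (add_pos (S.f_pos 0 s hs) (S.f_pos 1 s hs)).ne'

/-- The probability that the hypothetical agent of the benchmark is correct given the signal `s`. -/
noncomputable def benchmarkProb (c s : ℝ) : ℝ :=
  if max (S.belief 0 s) (S.belief 1 s) < 1 - c then 1 else max (S.belief 0 s) (S.belief 1 s)

lemma benchmark_eq (c : ℝ) : S.benchmark c =
    ∫ s in signalSpace, (S.f 0 s + S.f 1 s) / 2 * S.benchmarkProb c s := rfl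

lemma aestronglyMeasurable_benchmarkProb (c : ℝ) :
    AEStronglyMeasurable (S.benchmarkProb c) (volume.restrict signalSpace) := by
  have h0 := (S.continuousOn_belief 0).aemeasurable (μ := volume) measurableSet_signalSpace
  have h1 := (S.continuousOn_belief 1).aemeasurable (μ := volume) measurableSet_signalSpace
  have hm : AEMeasurable (fun s => max (S.belief 0 s) (S.belief 1 s))
    (volume.restrict signalSpace) := h0.max h1
  have hφ : Measurable fun t : ℝ => if t < 1 - c then 1 else t :=
    Measurable.ite measurableSet_Iio measurable_const measurable_id
  exact (hφ.comp_aemeasurable hm).aestronglyMeasurable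

lemma benchmarkProb_mem {c s : ℝ} (hs : s ∈ signalSpace) :
    S.benchmarkProb c s ∈ Set.Icc 0 1 := by
  rw [benchmarkProb]
  split_ifs
  · simp
  · exact ⟨le_max_of_le_left (S.belief_pos 0 hs).le,
      max_le (S.belief_le_one 0 hs) (S.belief_le_one 1 hs)⟩

lemma integrableOn_benchmark (c : ℝ) :
    IntegrableOn (fun s => (S.f 0 s + S.f 1 s) / 2 * S.benchmarkProb c s) signalSpace := by
  refine (((S.integrableOn_f 0).add (S.integrableOn_f 1)).div_const 2).mul_bdd (c := 1)
    (S.aestronglyMeasurable_benchmarkProb c) ?_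
  filter_upwards [ae_restrict_mem measurableSet_signalSpace] with s hs
  have := S.benchmarkProb_mem (c := c) hs
  rw [Real.norm_of_nonneg this.1]
  exact this.2

/-- Almost surely an agent is not indifferent between learning the state at cost `c` and not. -/
lemma ae_max_belief_ne (c : ℝ) :
    ∀ᵐ s ∂(volume.restrict signalSpace), max (S.belief 0 s) (S.belief 1 s) ≠ 1 - c := by
  have hinj := S.strictMonoOn_belief_one.injOn
  have h1 : (signalSpace ∩ {s | S.belief 1 s = 1 - c}).Subsingleton := fun s hs t ht =>
    hinj hs.1 ht.1 (hs.2.trans ht.2.symm)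
  have h0 : (signalSpace ∩ {s | S.belief 0 s = 1 - c}).Subsingleton := fun s hs t ht =>
    hinj hs.1 ht.1 (by
      have h3 := S.belief_add hs.1
      have h4 := S.belief_add ht.1
      have h5 : S.belief 0 s = 1 - c := hs.2
      have h6 : S.belief 0 t = 1 - c := ht.2
      linarith)
  have hz := measure_union_null (h0.measure_zero volume) (h1.measure_zero volume)
  rw [ae_restrict_iff' measurableSet_signalSpace]
  filter_upwards [measure_eq_zero_iff_ae_notMem.mp hz] with s hs hsS heq
  rcases max_choice (S.belief 0 s) (S.belief 1 s) with h | h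
  · exact hs (Or.inl ⟨hsS, h.symm.trans heq⟩)
  · exact hs (Or.inr ⟨hsS, h.symm.trans heq⟩)

end SignalStructure

/-! ### Bayes errors and optimal behavior. -/

namespace StrategyProfile
variable {K : ℕ → ℕ} (σ : StrategyProfile K) (S : SignalStructure)

lemma historyProb_nonneg (θ : Fin 2) (B : Finset ℕ) (h : B → Fin 2) :
    0 ≤ σ.historyProb S θ B h := measureReal_nonneg

lemma sum_historyProb_filter (θ : Fin 2) (B : Finset ℕ) (d : (B → Fin 2) → Fin 2) (y : Fin 2) :
    (S.signalsLaw θ).real {x | d (fun m => σ.action x m.1) = y} =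
      ∑ h : B → Fin 2, if d h = y then σ.historyProb S θ B h else 0 := by
  have hA : Measurable fun (x : ℕ → ℝ) (m : B) => σ.action x m.1 :=
    measurable_pi_lambda _ fun m => σ.measurable_action m.1
  rw [← Finset.sum_filter]
  have := sum_measureReal_preimage_singleton (μ := S.signalsLaw θ)
    (f := fun (x : ℕ → ℝ) (m : B) => σ.action x m.1) (Finset.univ.filter fun h => d h = y)
    (fun h _ => hA (measurableSet_singleton h))
  convert this.symm using 2 with h
  · ext x; simp
  · rw [historyProb]
    congr 1
    ext x
    simp [funext_iff]

lemma sum_historyProb (θ : Fin 2) (B : Finset ℕ) : ∑ h, σ.historyProb S θ B h = 1 := by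
  have := σ.sum_historyProb_filter S θ B (fun _ => 0) 0
  simpa using this.symm

lemma historyProb_empty (θ : Fin 2) (h : (∅ : Finset ℕ) → Fin 2) :
    σ.historyProb S θ ∅ h = 1 := by
  rw [← σ.sum_historyProb S θ ∅, Fintype.sum_eq_single h]
  intro g hg
  exact absurd (Subsingleton.elim g h) hg

/-- The smallest error probability, given the signal `s`, of an agent who observes `B`. -/
noncomputable def bayesError (s : ℝ) (B : Finset ℕ) : ℝ :=
  ∑ h : B → Fin 2,
    min (S.belief 0 s * σ.historyProb S 0 B h) (S.belief 1 s * σ.historyProb S 1 B h)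

/-- In `Fin 2`, `1 - a` is the state other than `a`, so the sum collects the mass of the wrong state
after each history. -/
lemma correctProb_eq {n : ℕ} {s : ℝ} (hs : s ∈ signalSpace) (B : Finset ℕ) :
    σ.correctProb S n s B = 1 - ∑ h : B → Fin 2,
      S.belief (1 - σ.act n s B h) s * σ.historyProb S (1 - σ.act n s B h) B h := by
  have h1 : (1 : ℝ) = ∑ h : B → Fin 2,
      (S.belief 0 s * σ.historyProb S 0 B h + S.belief 1 s * σ.historyProb S 1 B h) := by
    rw [Finset.sum_add_distrib, ← Finset.mul_sum, ← Finset.mul_sum, sum_historyProb,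
      sum_historyProb, mul_one, mul_one, S.belief_add hs]
  rw [correctProb, Fin.sum_univ_two, sum_historyProb_filter, sum_historyProb_filter, h1,
    Finset.mul_sum, Finset.mul_sum, ← Finset.sum_add_distrib, ← Finset.sum_sub_distrib]
  refine Finset.sum_congr rfl fun h _ => ?_
  generalize σ.act n s B h = a
  fin_cases a <;> simp

lemma correctProb_le {n : ℕ} {s : ℝ} (hs : s ∈ signalSpace) (B : Finset ℕ) :
    σ.correctProb S n s B ≤ 1 - σ.bayesError S s B := by
  rw [correctProb_eq _ _ hs, bayesError]
  refine sub_le_sub_left (Finset.sum_le_sum fun h _ => ?_) 1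
  generalize σ.act n s B h = a
  fin_cases a <;> simp

lemma bayesError_nonneg {s : ℝ} (hs : s ∈ signalSpace) (B : Finset ℕ) :
    0 ≤ σ.bayesError S s B :=
  Finset.sum_nonneg fun h _ => le_min
    (mul_nonneg (S.belief_pos 0 hs).le (σ.historyProb_nonneg S 0 B h))
    (mul_nonneg (S.belief_pos 1 hs).le (σ.historyProb_nonneg S 1 B h))

lemma correctProb_le_one {n : ℕ} {s : ℝ} (hs : s ∈ signalSpace) (B : Finset ℕ) :
    σ.correctProb S n s B ≤ 1 := by
  linarith [σ.correctProb_le S (n := n) hs B, σ.bayesError_nonneg S hs B]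

lemma correctProb_nonneg {n : ℕ} {s : ℝ} (hs : s ∈ signalSpace) (B : Finset ℕ) :
    0 ≤ σ.correctProb S n s B :=
  Finset.sum_nonneg fun θ _ => mul_nonneg (S.belief_pos θ hs).le measureReal_nonneg

lemma one_sub_bayesError_empty {s : ℝ} (hs : s ∈ signalSpace) :
    1 - σ.bayesError S s ∅ = max (S.belief 0 s) (S.belief 1 s) := by
  have := S.belief_add hs
  rw [bayesError, Fintype.sum_unique, historyProb_empty, historyProb_empty, mul_one, mul_one]
  rcases le_total (S.belief 0 s) (S.belief 1 s) with h | h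
  · rw [min_eq_left h, max_eq_right h]; linarith
  · rw [min_eq_right h, max_eq_left h]; linarith

variable {σ S} {c : ℝ}

/-- An optimal action weighs the likelihoods of the observed history in the two states. -/
lemma IsPerfectBayesian.likelihood_le (hσ : σ.IsPerfectBayesian S c) {n : ℕ} {s : ℝ}
    (hs : s ∈ signalSpace) {B : Finset ℕ} (hB : Feasible K n B) (h : B → Fin 2) (y : Fin 2) :
    S.f y s * σ.historyProb S y B h ≤
      S.f (σ.act n s B h) s * σ.historyProb S (σ.act n s B h) B h := by
  have hp := hσ.act_optimal n s hs B hB h y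
  have hn : ∀ θ, 0 ≤ S.f θ s * σ.historyProb S θ B h := fun θ =>
    mul_nonneg (S.f_pos θ s hs).le (σ.historyProb_nonneg S θ B h)
  -- When the history has probability zero in both states, the posterior is `0 / 0` and says
  -- nothing, but both sides vanish.
  rcases (add_nonneg (hn 0) (hn 1)).eq_or_lt with h0 | h0
  · have hz : ∀ θ, S.f θ s * σ.historyProb S θ B h = 0 := by
      refine Fin.forall_fin_two.mpr ⟨?_, ?_⟩
      · exact le_antisymm (by linarith [hn 1]) (hn 0)
      · exact le_antisymm (by linarith [hn 0]) (hn 1)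
    rw [hz, hz]
  · rw [posterior, posterior, div_le_div_iff_of_pos_right h0] at hp
    exact hp

lemma correctProb_eq_of_likelihood {n : ℕ} {s : ℝ} (hs : s ∈ signalSpace) {B : Finset ℕ}
    (hl : ∀ (h : B → Fin 2) (y : Fin 2), S.f y s * σ.historyProb S y B h ≤
      S.f (σ.act n s B h) s * σ.historyProb S (σ.act n s B h) B h) :
    σ.correctProb S n s B = 1 - σ.bayesError S s B := by
  rw [correctProb_eq _ _ hs, bayesError]
  congr 1
  refine Finset.sum_congr rfl fun h _ => ?_
  have h2 := hl h
  have hpos := add_pos (S.f_pos 0 s hs) (S.f_pos 1 s hs)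
  have hb : ∀ y, S.belief y s * σ.historyProb S y B h ≤
      S.belief (σ.act n s B h) s * σ.historyProb S (σ.act n s B h) B h := by
    intro y
    have := h2 y
    rw [← S.mass_mul_belief y hs, ← S.mass_mul_belief (σ.act _ _ _ _) hs, mul_assoc,
      mul_assoc] at this
    exact le_of_mul_le_mul_left this hpos
  generalize σ.act n s B h = a at hb
  fin_cases a
  · simpa using (hb 1)
  · simpa using (hb 0)

lemma IsPerfectBayesian.correctProb_eq (hσ : σ.IsPerfectBayesian S c) {n : ℕ} {s : ℝ}
    (hs : s ∈ signalSpace) {B : Finset ℕ} (hB : Feasible K n B) :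
    σ.correctProb S n s B = 1 - σ.bayesError S s B :=
  correctProb_eq_of_likelihood hs fun h y => hσ.likelihood_le hs hB h y

lemma feasible_empty (n : ℕ) : Feasible K n ∅ := ⟨by simp, by simp⟩

/-- Revealed preference: every feasible `B` gives a lower bound for the equilibrium payoff. -/
lemma IsPerfectBayesian.one_sub_bayesError_le (hσ : σ.IsPerfectBayesian S c) (hc : 0 ≤ c) {n : ℕ}
    {s : ℝ} (hs : s ∈ signalSpace) {B : Finset ℕ} (hB : Feasible K n B) :
    1 - σ.bayesError S s B - c ≤ σ.expectedPayoff S c n s (σ.nbhd n s) := by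
  refine le_trans ?_ (hσ.nbhd_optimal n s hs B hB)
  rw [expectedPayoff_eq, hσ.correctProb_eq hs hB]
  split_ifs <;> linarith

lemma IsPerfectBayesian.max_belief_le (hσ : σ.IsPerfectBayesian S c) {n : ℕ}
    {s : ℝ} (hs : s ∈ signalSpace) :
    max (S.belief 0 s) (S.belief 1 s) ≤ σ.expectedPayoff S c n s (σ.nbhd n s) := by
  have := hσ.nbhd_optimal n s hs ∅ (feasible_empty n)
  rwa [expectedPayoff_eq, hσ.correctProb_eq hs (feasible_empty n), if_pos rfl, sub_zero,
    one_sub_bayesError_empty _ _ hs] at this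

/-- An agent whose private belief is strong enough does not observe. -/
lemma IsPerfectBayesian.nbhd_eq_empty (hσ : σ.IsPerfectBayesian S c) {n : ℕ}
    {s : ℝ} (hs : s ∈ signalSpace) (hm : 1 - c < max (S.belief 0 s) (S.belief 1 s)) :
    σ.nbhd n s = ∅ := by
  by_contra hne
  have h := hσ.max_belief_le (n := n) hs
  rw [expectedPayoff_eq, if_neg hne] at h
  linarith [σ.correctProb_le_one S (n := n) hs (σ.nbhd n s)]

lemma IsPerfectBayesian.correctProb_of_nbhd_empty (hσ : σ.IsPerfectBayesian S c) {n : ℕ}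
    {s : ℝ} (hs : s ∈ signalSpace) (hm : σ.nbhd n s = ∅) :
    σ.correctProb S n s (σ.nbhd n s) = max (S.belief 0 s) (S.belief 1 s) := by
  rw [hm, hσ.correctProb_eq hs (feasible_empty n), one_sub_bayesError_empty _ _ hs]

/-- An agent with an extreme signal follows it. -/
lemma IsPerfectBayesian.act_of_lt_belief (hσ : σ.IsPerfectBayesian S c) (hc : c < 1 / 2) {n : ℕ}
    {s : ℝ} (hs : s ∈ signalSpace) {θ : Fin 2} (hm : 1 - c < S.belief θ s)
    (a : ℕ → Fin 2) : σ.act n s (σ.nbhd n s) (fun m => a m.1) = θ := by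
  have hmax : S.belief θ s ≤ max (S.belief 0 s) (S.belief 1 s) := by
    fin_cases θ
    · exact le_max_left _ _
    · exact le_max_right _ _
  rw [hσ.nbhd_eq_empty (n := n) hs (hm.trans_le hmax)]
  have h2 := hσ.likelihood_le hs (feasible_empty n) (fun m => a m.1) θ
  rw [historyProb_empty, historyProb_empty, mul_one, mul_one, ← S.mass_mul_belief _ hs,
    ← S.mass_mul_belief (σ.act _ _ _ _) hs] at h2
  have h3 := le_of_mul_le_mul_left h2 (add_pos (S.f_pos 0 s hs) (S.f_pos 1 s hs))
  have h4 := S.belief_add hs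
  generalize σ.act n s ∅ (fun m => a m.1) = b at h3
  by_contra hne
  fin_cases θ <;> fin_cases b <;> simp at h3 hm hne <;> linarith

end StrategyProfile
-- Infinite observations suffice: informative actions and geometric decay of errors.
namespace SignalStructure
variable (S : SignalStructure) {c : ℝ}

lemma StrongPrivateBeliefs.exists_forall_lt (hstrong : S.StrongPrivateBeliefs c) :
    ∃ t ∈ signalSpace, ∀ s ∈ Set.Ioo t 1, s ∈ signalSpace ∧ 1 - c < S.belief 1 s := by
  obtain ⟨⟨t, ht, hb⟩, -⟩ := hstrong
  refine ⟨t, ht, fun s hs => ?_⟩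
  have hsS : s ∈ signalSpace := ⟨ht.1.trans hs.1, hs.2⟩
  exact ⟨hsS, hb ▸ S.strictMonoOn_belief_one ht hsS hs.1⟩

lemma integral_signalSpace_neg (g : ℝ → ℝ) :
    ∫ s in signalSpace, g (-s) = ∫ s in signalSpace, g s := by
  have hm : MeasurePreserving (fun s : ℝ => -s) volume volume := Measure.measurePreserving_neg _
  have := hm.setIntegral_preimage_emb (Homeomorph.neg ℝ).measurableEmbedding g signalSpace
  rw [← this]
  congr 2
  ext s
  simp only [signalSpace, Set.mem_preimage, Set.mem_Ioo]
  constructor <;> rintro ⟨h1, h2⟩ <;> constructor <;> linarith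

end SignalStructure

/-- Two coins whose biases differ have Bhattacharyya coefficient bounded away from `1`. -/
lemma sqrt_mul_add_sqrt_mul_le {p q δ : ℝ} (hp : p ∈ Set.Icc 0 1) (hq : q ∈ Set.Icc 0 1)
    (hδ : 0 ≤ δ) (h : δ ≤ q - p) :
    √p * √q + √(1 - p) * √(1 - q) ≤ 1 - δ ^ 2 / 4 := by
  -- One minus the coefficient is half the sum of the squared differences of square roots. Each
  -- square is at least `δ ^ 2 / 4`, since the two roots add up to at most `2`.
  have key : ∀ a b : ℝ, 0 ≤ a → 0 ≤ b → a ≤ 1 → b ≤ 1 → δ ≤ b ^ 2 - a ^ 2 →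
      δ ^ 2 / 4 ≤ (b - a) ^ 2 := by
    intro a b ha hb ha1 hb1 hab
    have h1 : δ ≤ (b - a) * (b + a) := by linarith
    have h0 : 0 ≤ b - a := by
      by_contra hn
      nlinarith [mul_nonneg (neg_nonneg.mpr (not_le.mp hn).le) (add_nonneg hb ha)]
    have h2 : δ ≤ (b - a) * 2 :=
      h1.trans (mul_le_mul_of_nonneg_left (by linarith) h0)
    nlinarith
  have s1 : √p ^ 2 = p := Real.sq_sqrt hp.1
  have s2 : √q ^ 2 = q := Real.sq_sqrt hq.1
  have s3 : √(1 - p) ^ 2 = 1 - p := Real.sq_sqrt (by linarith [hp.2])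
  have s4 : √(1 - q) ^ 2 = 1 - q := Real.sq_sqrt (by linarith [hq.2])
  have k1 := key (√p) (√q) (by positivity) (by positivity) (Real.sqrt_le_one.mpr hp.2)
    (Real.sqrt_le_one.mpr hq.2) (by linarith)
  have k2 := key (√(1 - q)) (√(1 - p)) (by positivity) (by positivity)
    (Real.sqrt_le_one.mpr (by linarith [hq.1])) (Real.sqrt_le_one.mpr (by linarith [hp.1]))
    (by linarith)
  nlinarith

namespace StrategyProfile
variable {K : ℕ → ℕ} (σ : StrategyProfile K) (S : SignalStructure)

/-- The probability of the actions `h` of the first `k` agents. -/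
noncomputable def fullProb (θ : Fin 2) (k : ℕ) (h : Fin k → Fin 2) : ℝ :=
  (S.signalsLaw θ).real {x | ∀ i : Fin k, σ.action x i = h i}

/-- An action sequence that starts with `h`. -/
def extend {k : ℕ} (h : Fin k → Fin 2) (m : ℕ) : Fin 2 :=
  if hm : m < k then h ⟨m, hm⟩ else 0

/-- The signals at which agent `k` chooses `y` when the actions before her are `a`. -/
def responseSet (k : ℕ) (a : ℕ → Fin 2) (y : Fin 2) : Set ℝ :=
  {s | σ.act k s (σ.nbhd k s) (fun m => a m.1) = y}

lemma measurableSet_responseSet (k : ℕ) (a : ℕ → Fin 2) (y : Fin 2) :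
    MeasurableSet (σ.responseSet k a y) :=
  σ.measurable_act_nbhd k id measurable_id (fun _ m => a m) (fun _ _ => measurable_const)
    (measurableSet_singleton y)

/-- The signal of agent `k` is independent of the earlier actions, and after `h` she plays `y`
exactly when it lies in the response set. She never reads the default values of `extend h` from `k`
on. -/
lemma fullProb_snoc (θ : Fin 2) {k : ℕ} (h : Fin k → Fin 2) (y : Fin 2) :
    σ.fullProb S θ (k + 1) (Fin.snoc (α := fun _ => Fin 2) h y) =
      σ.fullProb S θ k h * (S.signalLaw θ).real (σ.responseSet k (extend h) y) := by
  have hm : MeasurableSet {x : ℕ → ℝ | ∀ i : Fin k, σ.action x i = h i} := by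
    simp only [Set.ofPred_forall]
    exact .iInter fun i => σ.measurable_action i (measurableSet_singleton (h i))
  have hr := σ.measurableSet_responseSet k (extend h) y
  have hind := (S.indepFun_eval_truncate θ k).measure_inter_preimage_eq_mul _ _ hr hm
  have h1 : truncate k ⁻¹' {x | ∀ i : Fin k, σ.action x i = h i} =
      {x | ∀ i : Fin k, σ.action x i = h i} := by
    ext x
    simp only [Set.mem_preimage, Set.mem_ofPred_eq]
    exact forall_congr' fun i => by rw [σ.action_truncate x i.2]
  have h2 : (S.signalsLaw θ) ((fun x => x k) ⁻¹' σ.responseSet k (extend h) y) =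
      S.signalLaw θ (σ.responseSet k (extend h) y) := by
    rw [← S.map_eval_signalsLaw θ k, Measure.map_apply (measurable_pi_apply k) hr]
  rw [h1, h2] at hind
  rw [fullProb, fullProb, Measure.real, Measure.real, Measure.real, mul_comm,
    ← ENNReal.toReal_mul, ← hind]
  congr 2
  ext x
  simp only [Set.mem_ofPred_eq, Set.mem_inter_iff, Set.mem_preimage, responseSet,
    Fin.forall_fin_succ', Fin.snoc_castSucc, Fin.snoc_last, Fin.val_castSucc, Fin.val_last]
  rw [and_comm]
  refine and_congr_left fun hx => ?_
  rw [action_eq]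
  have : (fun m : σ.nbhd k (x k) => σ.action x m.1) = fun m => extend h m.1 := by
    funext m
    have hmk := σ.lt_of_mem_nbhd m
    simp only [extend, dif_pos hmk]
    exact hx ⟨m.1, hmk⟩
  rw [this]

lemma fullProb_le_historyProb (θ : Fin 2) {k : ℕ} (h : Fin k → Fin 2) {B : Finset ℕ}
    (hB : B ⊆ Finset.range k) :
    σ.fullProb S θ k h ≤ σ.historyProb S θ B (fun m => extend h m.1) := by
  refine measureReal_mono fun x hx m => ?_
  have hmk := Finset.mem_range.mp (hB m.2)
  simp only [extend, dif_pos hmk]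
  exact hx ⟨m.1, hmk⟩

lemma sum_response (θ : Fin 2) (k : ℕ) (a : ℕ → Fin 2) :
    (S.signalLaw θ).real (σ.responseSet k a 0) =
      1 - (S.signalLaw θ).real (σ.responseSet k a 1) := by
  rw [← probReal_compl_eq_one_sub (σ.measurableSet_responseSet k a 1)]
  congr 1
  ext s
  simp only [responseSet, Set.mem_ofPred_eq, Set.mem_compl_iff]
  generalize σ.act k s (σ.nbhd k s) (fun m => a m.1) = b
  fin_cases b <;> simp

variable {σ S} {c : ℝ}

/-- By symmetry, an agent who follows a low signal against the likelihoods does so with the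
opposite high signal, too. -/
lemma IsSymmetricEquilibrium.response_mono (hσ : σ.IsSymmetricEquilibrium S c) {k : ℕ}
    {h : Fin k → Fin 2} (h0 : 0 < σ.fullProb S 0 k h) (h1 : 0 < σ.fullProb S 1 k h) {s : ℝ}
    (hs : s ∈ signalSpace) (hpos : 0 < s) (hact : -s ∈ σ.responseSet k (extend h) 1) :
    s ∈ σ.responseSet k (extend h) 1 := by
  by_contra hne
  have hn := hσ.2 k s ⟨hpos.le, hs.2⟩
  have hf := σ.feasible k s
  have a1 : σ.act k (-s) (σ.nbhd k s) (fun m => extend h m.1) = 1 := by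
    rw [hn]; exact hact
  have a0 : σ.act k s (σ.nbhd k s) (fun m => extend h m.1) = 0 := by
    have : σ.act k s (σ.nbhd k s) (fun m => extend h m.1) ≠ 1 := hne
    generalize σ.act k s (σ.nbhd k s) (fun m => extend h m.1) = b at this
    fin_cases b <;> simp_all
  -- Since the neighborhood is the same at `s` and `-s`, the two optimality conditions concern the
  -- same likelihoods `P 0`, `P 1` of the history. They add up to `f 1 s * (P 0 + P 1) ≤ f 0 s * (P
  -- 0 + P 1)`, contradicting `f 0 s < f 1 s`.
  have l1 := hσ.1.likelihood_le (SignalStructure.neg_mem_signalSpace hs) hf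
    (fun m => extend h m.1) 0
  have l0 := hσ.1.likelihood_le hs hf (fun m => extend h m.1) 1
  rw [a1, ← S.symm s hs, ← S.f_zero_eq hs] at l1
  rw [a0] at l0
  have p0 := h0.trans_le (σ.fullProb_le_historyProb S 0 h hf.1)
  have p1 := h1.trans_le (σ.fullProb_le_historyProb S 1 h hf.1)
  have hlt := S.f_lt_of_pos hs hpos
  have q0 := mul_lt_mul_of_pos_right hlt p0
  have q1 := mul_lt_mul_of_pos_right hlt p1
  linarith

/-- Every action is informative about the state, whatever the actions before it. -/
lemma exists_informative (S : SignalStructure) (hc : c < 1 / 2)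
    (hstrong : S.StrongPrivateBeliefs c) :
    ∃ δ : ℝ, 0 < δ ∧ δ ≤ 1 ∧ ∀ (K : ℕ → ℕ) (σ : StrategyProfile K),
      σ.IsSymmetricEquilibrium S c → ∀ (k : ℕ) (h : Fin k → Fin 2),
      0 < σ.fullProb S 0 k h → 0 < σ.fullProb S 1 k h →
      δ ≤ (S.signalLaw 1).real (σ.responseSet k (extend h) 1) -
        (S.signalLaw 0).real (σ.responseSet k (extend h) 1) := by
  obtain ⟨t, ht, htop⟩ := SignalStructure.StrongPrivateBeliefs.exists_forall_lt S hstrong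
  have hfpos : ∀ s ∈ Set.Ioo t 1, 0 < S.f 1 s - S.f 0 s := by
    intro s hs
    obtain ⟨hsS, hb⟩ := htop s hs
    have hadd := S.belief_add hsS
    have := mul_lt_mul_of_pos_left (show S.belief 0 s < S.belief 1 s by linarith)
      (add_pos (S.f_pos 0 s hsS) (S.f_pos 1 s hsS))
    rw [S.mass_mul_belief 0 hsS, S.mass_mul_belief 1 hsS] at this
    linarith
  have hsub : Set.Ioo t 1 ⊆ signalSpace := fun s hs => (htop s hs).1
  have hD : IntegrableOn (fun s => S.f 1 s - S.f 0 s) signalSpace :=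
    (S.integrableOn_f 1).sub (S.integrableOn_f 0)
  have hI : 0 < ∫ s in Set.Ioo t 1, (S.f 1 s - S.f 0 s) := by
    rw [setIntegral_pos_iff_support_of_nonneg_ae _ (hD.mono_set hsub)]
    · refine lt_of_lt_of_le ?_ (measure_mono (s := Set.Ioo t 1) fun s hs =>
        ⟨(hfpos s hs).ne', hs⟩)
      simpa using ht.2
    · filter_upwards [ae_restrict_mem measurableSet_Ioo] with s hs
      exact (hfpos s hs).le
  -- The half comes from averaging over `s` and `-s` below; the cap `1` keeps `1 - δ ^ 2 / 4`
  -- nonnegative.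
  refine ⟨min 1 ((∫ s in Set.Ioo t 1, (S.f 1 s - S.f 0 s)) / 2), by positivity, min_le_left _ _,
    fun K σ hσ k h h0 h1 => (min_le_right _ _).trans ?_⟩
  set A := σ.responseSet k (extend h) 1 with hA
  have hAm : MeasurableSet A := σ.measurableSet_responseSet k (extend h) 1
  have hint : ∀ {E : Set ℝ}, MeasurableSet E →
      IntegrableOn (fun s => (S.f 1 s - S.f 0 s) * E.indicator 1 s) signalSpace := by
    intro E hE
    refine hD.mul_bdd (c := 1) (measurable_one.indicator hE).aestronglyMeasurable
      (Eventually.of_forall fun s => ?_)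
    by_cases hs : s ∈ E <;> simp [hs]
  have hintf : ∀ θ, IntegrableOn (fun s => S.f θ s * A.indicator 1 s) signalSpace := by
    intro θ
    refine (S.integrableOn_f θ).mul_bdd (c := 1)
      (measurable_one.indicator hAm).aestronglyMeasurable (Eventually.of_forall fun s => ?_)
    by_cases hs : s ∈ A <;> simp [hs]
  have e1 : (S.signalLaw 1).real A - (S.signalLaw 0).real A =
      ∫ s in signalSpace, (S.f 1 s - S.f 0 s) * A.indicator 1 s := by
    rw [S.signalLaw_real 1 hAm, S.signalLaw_real 0 hAm, ← integral_sub (hintf 1) (hintf 0)]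
    exact integral_congr_ae (Eventually.of_forall fun s => by simp only; ring)
  have hnegm : MeasurableSet ((fun s : ℝ => -s) ⁻¹' A) := measurable_neg hAm
  -- As `f 1 - f 0` is odd, twice the difference of the response probabilities is the integral of `f
  -- 1 - f 0` against `1_A(s) - 1_A(-s)`.
  have e2 : ∫ s in signalSpace, (S.f 1 s - S.f 0 s) * A.indicator 1 s =
      -∫ s in signalSpace, (S.f 1 s - S.f 0 s) * ((fun s : ℝ => -s) ⁻¹' A).indicator 1 s := by
    rw [← SignalStructure.integral_signalSpace_neg, ← integral_neg]
    refine setIntegral_congr_fun SignalStructure.measurableSet_signalSpace fun s hs => ?_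
    have : A.indicator (1 : ℝ → ℝ) (-s) = ((fun s : ℝ => -s) ⁻¹' A).indicator 1 s := rfl
    simp only [← S.symm s hs, ← S.f_zero_eq hs, this]
    ring
  -- By `response_mono` this integrand is nonnegative everywhere; on `Set.Ioo t 1` agents follow
  -- their signals, so there it equals `f 1 - f 0`.
  have e3 : ∫ s in Set.Ioo t 1, (S.f 1 s - S.f 0 s) ≤
      ∫ s in signalSpace, ((S.f 1 s - S.f 0 s) * A.indicator 1 s -
        (S.f 1 s - S.f 0 s) * ((fun s : ℝ => -s) ⁻¹' A).indicator 1 s) := by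
    have : ∫ s in Set.Ioo t 1, (S.f 1 s - S.f 0 s) = ∫ s in signalSpace,
        (S.f 1 s - S.f 0 s) * (Set.Ioo t 1).indicator 1 s := by
      rw [← Set.inter_eq_right.mpr hsub, ← setIntegral_indicator measurableSet_Ioo,
        Set.inter_eq_right.mpr hsub]
      refine integral_congr_ae (Eventually.of_forall fun s => ?_)
      by_cases hs : s ∈ Set.Ioo t 1 <;> simp [hs]
    rw [this]
    refine setIntegral_mono_on (hint measurableSet_Ioo) ((hint hAm).sub (hint hnegm))
      SignalStructure.measurableSet_signalSpace fun s hs => ?_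
    have hpre : ((fun s : ℝ => -s) ⁻¹' A).indicator (1 : ℝ → ℝ) s = A.indicator 1 (-s) := rfl
    rw [hpre, ← mul_sub]
    have hle : ∀ {u v : ℝ}, (u ∈ A → v ∈ A) → A.indicator (1 : ℝ → ℝ) u ≤ A.indicator 1 v := by
      intro u v huv
      by_cases hu : u ∈ A
      · simp [hu, huv hu]
      · rw [Set.indicator_of_notMem hu]
        exact Set.indicator_nonneg (fun _ _ => zero_le_one) _
    rcases lt_trichotomy s 0 with hneg | rfl | hpos
    · have hs' := SignalStructure.neg_mem_signalSpace hs
      have hlt := S.f_lt_of_pos hs' (neg_pos.mpr hneg)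
      rw [← S.symm s hs, ← S.f_zero_eq hs] at hlt
      have hmem : s ∉ Set.Ioo t 1 := fun hmem => by linarith [hfpos s hmem]
      rw [Set.indicator_of_notMem hmem, mul_zero]
      refine mul_nonneg_of_nonpos_of_nonpos (by linarith) (sub_nonpos.mpr (hle fun hsA => ?_))
      exact hσ.response_mono h0 h1 hs' (neg_pos.mpr hneg) (by rwa [neg_neg])
    · have hz : S.f 1 0 - S.f 0 0 = 0 := by
        rw [S.symm 0 hs, neg_zero, sub_self]
      rw [hz, zero_mul, zero_mul]
    · refine mul_le_mul_of_nonneg_left ?_ (sub_nonneg.mpr (S.f_lt_of_pos hs hpos).le)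
      by_cases hmem : s ∈ Set.Ioo t 1
      · obtain ⟨hsS, hb⟩ := htop s hmem
        have m1 : s ∈ A := hσ.1.act_of_lt_belief hc hsS hb _
        have m2 : -s ∉ A := by
          have hb' : 1 - c < S.belief 0 (-s) := by rwa [S.belief_zero_neg hsS]
          have := hσ.1.act_of_lt_belief (n := k) hc (SignalStructure.neg_mem_signalSpace hsS) hb'
            (extend h)
          intro hA1
          exact zero_ne_one (this.symm.trans hA1)
        simp [m1, m2, hmem]
      · rw [Set.indicator_of_notMem hmem]
        exact sub_nonneg.mpr (hle fun hA1 => hσ.response_mono h0 h1 hs hpos hA1)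
  have e4 := integral_sub (hint hAm) (hint hnegm)
  rw [e4] at e3
  linarith

/-- The overlap of the laws of the first `k` actions in the two states decays exponentially. -/
lemma IsSymmetricEquilibrium.sum_sqrt_fullProb_le {δ : ℝ} (hδ : 0 ≤ δ) (hδ1 : δ ≤ 1)
    (hinf : ∀ (k : ℕ) (h : Fin k → Fin 2), 0 < σ.fullProb S 0 k h → 0 < σ.fullProb S 1 k h →
      δ ≤ (S.signalLaw 1).real (σ.responseSet k (extend h) 1) -
        (S.signalLaw 0).real (σ.responseSet k (extend h) 1)) (k : ℕ) :
    ∑ h : Fin k → Fin 2, √(σ.fullProb S 0 k h) * √(σ.fullProb S 1 k h) ≤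
      (1 - δ ^ 2 / 4) ^ k := by
  have hρ : 0 ≤ 1 - δ ^ 2 / 4 := by nlinarith
  induction k with
  | zero => simp [fullProb]
  | succ k ih =>
    have hstep : ∀ h : Fin k → Fin 2, ∑ y : Fin 2,
        √(σ.fullProb S 0 (k + 1) (Fin.snoc (α := fun _ => Fin 2) h y)) *
          √(σ.fullProb S 1 (k + 1) (Fin.snoc (α := fun _ => Fin 2) h y)) ≤
        (1 - δ ^ 2 / 4) * (√(σ.fullProb S 0 k h) * √(σ.fullProb S 1 k h)) := by
      intro h
      have n0 : 0 ≤ σ.fullProb S 0 k h := measureReal_nonneg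
      have n1 : 0 ≤ σ.fullProb S 1 k h := measureReal_nonneg
      simp only [fullProb_snoc, Real.sqrt_mul n0, Real.sqrt_mul n1, Fin.sum_univ_two, sum_response]
      -- Histories impossible in one of the states contribute nothing, so informativeness is needed
      -- only at the others.
      rcases n0.eq_or_lt with z | p0
      · rw [← z]; simp
      rcases n1.eq_or_lt with z | p1
      · rw [← z]; simp
      have := sqrt_mul_add_sqrt_mul_le (p := (S.signalLaw 0).real (σ.responseSet k (extend h) 1))
        ⟨measureReal_nonneg, measureReal_le_one⟩ ⟨measureReal_nonneg, measureReal_le_one⟩ hδ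
        (hinf k h p0 p1)
      have := mul_le_mul_of_nonneg_left this
        (mul_nonneg (Real.sqrt_nonneg (σ.fullProb S 0 k h)) (Real.sqrt_nonneg (σ.fullProb S 1 k h)))
      linarith
    rw [← (Fin.snocEquiv fun _ => Fin 2).sum_comp, Fintype.sum_prod_type_right]
    calc _ ≤ ∑ h : Fin k → Fin 2,
          (1 - δ ^ 2 / 4) * (√(σ.fullProb S 0 k h) * √(σ.fullProb S 1 k h)) :=
        Finset.sum_le_sum fun h _ => hstep h
      _ ≤ _ := by
        rw [← Finset.mul_sum, pow_succ' _ k]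
        exact mul_le_mul_of_nonneg_left ih hρ

/-- The minimum of two nonnegative numbers is at most their geometric mean; the beliefs are bounded
by `1`. -/
lemma bayesError_range_le {s : ℝ} (hs : s ∈ signalSpace) (k : ℕ) :
    σ.bayesError S s (Finset.range k) ≤
      ∑ h : Fin k → Fin 2, √(σ.fullProb S 0 k h) * √(σ.fullProb S 1 k h) := by
  let e : Fin k ≃ Finset.range k :=
    { toFun := fun i => ⟨i, Finset.mem_range.mpr i.2⟩
      invFun := fun m => ⟨m, Finset.mem_range.mp m.2⟩
      left_inv := fun _ => rfl
      right_inv := fun _ => rfl }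
  rw [bayesError, ← (e.arrowCongr (Equiv.refl (Fin 2))).sum_comp]
  refine Finset.sum_le_sum fun h _ => ?_
  have hH : ∀ θ, σ.historyProb S θ (Finset.range k) (e.arrowCongr (Equiv.refl (Fin 2)) h) =
      σ.fullProb S θ k h := by
    intro θ
    rw [historyProb, fullProb]
    congr 1
    ext x
    exact e.symm.forall_congr fun _ => Iff.rfl
  rw [hH, hH]
  have n0 : 0 ≤ σ.fullProb S 0 k h := measureReal_nonneg
  have n1 : 0 ≤ σ.fullProb S 1 k h := measureReal_nonneg
  have hmin : 0 ≤ min (S.belief 0 s * σ.fullProb S 0 k h) (S.belief 1 s * σ.fullProb S 1 k h) :=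
    le_min (mul_nonneg (S.belief_pos 0 hs).le n0) (mul_nonneg (S.belief_pos 1 hs).le n1)
  rw [← Real.mul_self_sqrt hmin]
  refine mul_le_mul (Real.sqrt_le_sqrt ?_) (Real.sqrt_le_sqrt ?_) (Real.sqrt_nonneg _)
    (Real.sqrt_nonneg _)
  · exact (min_le_left _ _).trans (mul_le_of_le_one_left n0 (S.belief_le_one 0 hs))
  · exact (min_le_right _ _).trans (mul_le_of_le_one_left n1 (S.belief_le_one 1 hs))

theorem IsSymmetricEquilibrium.maximalLearning (hσ : σ.IsSymmetricEquilibrium S c) (hc0 : 0 ≤ c)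
    (hc : c < 1 / 2) (hstrong : S.StrongPrivateBeliefs c) (hK : InfiniteObservations K) :
    σ.MaximalLearning S c := by
  obtain ⟨δ, hδ, hδ1, hinf⟩ := exists_informative S hc hstrong
  have herr : Tendsto (fun n => (1 - δ ^ 2 / 4) ^ (min (K n) n)) atTop (𝓝 0) := by
    refine (tendsto_pow_atTop_nhds_zero_of_lt_one (by nlinarith) (by nlinarith)).comp ?_
    exact tendsto_atTop.mpr fun b => by
      filter_upwards [hK.eventually_ge_atTop b, eventually_ge_atTop b] with n h1 h2
      exact le_min h1 h2
  have hpay : ∀ n, ∀ s ∈ signalSpace, 1 - (1 - δ ^ 2 / 4) ^ (min (K n) n) - c ≤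
      σ.expectedPayoff S c n s (σ.nbhd n s) := by
    intro n s hs
    have hB : Feasible K n (Finset.range (min (K n) n)) :=
      ⟨Finset.range_subset_range.mpr (min_le_right _ _), by simp⟩
    have h1 := hσ.1.one_sub_bayesError_le hc0 hs hB
    have h2 := σ.bayesError_range_le (S := S) hs (min (K n) n)
    have h3 := sum_sqrt_fullProb_le (S := S) hδ.le hδ1 (hinf K σ hσ) (min (K n) n)
    linarith
  rw [MaximalLearning, S.benchmark_eq]
  simp_rw [fun n => (σ.learningProb_eq_integral S n).2]
  refine tendsto_integral_of_dominated_convergence (fun s => (S.f 0 s + S.f 1 s) / 2)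
    (fun n => (σ.learningProb_eq_integral S n).1.aestronglyMeasurable)
    (((S.integrableOn_f 0).add (S.integrableOn_f 1)).div_const 2) (fun n => ?_) ?_
  · filter_upwards [ae_restrict_mem SignalStructure.measurableSet_signalSpace] with s hs
    have hm := add_pos (S.f_pos 0 s hs) (S.f_pos 1 s hs)
    rw [Real.norm_of_nonneg (mul_nonneg (by linarith) (σ.correctProb_nonneg S hs _))]
    exact mul_le_of_le_one_right (by linarith) (σ.correctProb_le_one S hs _)
  · filter_upwards [ae_restrict_mem SignalStructure.measurableSet_signalSpace,
      S.ae_max_belief_ne c] with s hs hne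
    refine Tendsto.const_mul _ ?_
    rw [SignalStructure.benchmarkProb]
    rcases lt_or_gt_of_ne hne with hlt | hgt
    · rw [if_pos hlt]
      have hlow : Tendsto (fun n => 1 - (1 - δ ^ 2 / 4) ^ (min (K n) n)) atTop (𝓝 1) := by
        simpa using herr.const_sub 1
      refine tendsto_of_tendsto_of_tendsto_of_le_of_le' hlow tendsto_const_nhds ?_
        (Eventually.of_forall fun n => σ.correctProb_le_one S hs _)
      -- Once the error is below `1 - c - max`, not observing is worse than observing the first
      -- agents. So she observes, and the cost cancels from the payoff bound.
      filter_upwards [herr.eventually_lt_const (sub_pos.mpr hlt)] with n hn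
      have h1 := hpay n s hs
      rw [expectedPayoff_eq] at h1
      by_cases hB : σ.nbhd n s = ∅
      · rw [if_pos hB, hσ.1.correctProb_of_nbhd_empty hs hB] at h1
        linarith
      · rw [if_neg hB] at h1
        linarith
    · rw [if_neg hgt.not_gt]
      refine tendsto_const_nhds.congr fun n => ?_
      rw [hσ.1.correctProb_of_nbhd_empty hs (hσ.1.nbhd_eq_empty hs hgt)]

end StrategyProfile
-- Infinite observations are necessary: errors under bounded capacity.
namespace SignalStructure
variable (S : SignalStructure) {c : ℝ}

/-- The signals at which the belief in the state `y` is extreme. -/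
def extremeSignals (c : ℝ) (y : Fin 2) : Set ℝ :=
  signalSpace ∩ {s | 1 - c < S.belief y s}

lemma isOpen_extremeSignals (y : Fin 2) : IsOpen (S.extremeSignals c y) :=
  (S.continuousOn_belief y).isOpen_inter_preimage isOpen_Ioo isOpen_Ioi

/-- The density is positive, so Lebesgue measure on the signal space is absolutely continuous with
respect to the signal law. -/
lemma signalLaw_pos (θ : Fin 2) {A : Set ℝ} (hA : IsOpen A) (hne : A.Nonempty)
    (hsub : A ⊆ signalSpace) : 0 < (S.signalLaw θ).real A := by
  rw [Measure.real, ENNReal.toReal_pos_iff]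
  refine ⟨?_, measure_lt_top _ _⟩
  have hac : volume.restrict signalSpace ≪ S.signalLaw θ := by
    refine withDensity_absolutelyContinuous' ?_ ?_
    · exact (S.integrableOn_f θ).aestronglyMeasurable.aemeasurable.ennreal_ofReal
    · filter_upwards [ae_restrict_mem measurableSet_signalSpace] with s hs
      exact (ENNReal.ofReal_pos.mpr (S.f_pos θ s hs)).ne'
  refine pos_iff_ne_zero.mpr fun h => ?_
  have h0 := hac h
  rw [Measure.restrict_apply hA.measurableSet, Set.inter_eq_left.mpr hsub] at h0
  exact (hA.measure_pos volume hne).ne' h0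

lemma StrongPrivateBeliefs.nonempty_extremeSignals (hstrong : S.StrongPrivateBeliefs c)
    (y : Fin 2) : (S.extremeSignals c y).Nonempty := by
  obtain ⟨t, ht, htop⟩ := SignalStructure.StrongPrivateBeliefs.exists_forall_lt S hstrong
  obtain ⟨s, hs⟩ := Set.nonempty_Ioo.mpr ht.2
  obtain ⟨hsS, hb⟩ := htop s hs
  fin_cases y
  · exact ⟨-s, neg_mem_signalSpace hsS, by simpa [S.belief_zero_neg hsS] using hb⟩
  · exact ⟨s, hsS, hb⟩

lemma StrongPrivateBeliefs.exists_extreme_prob (hstrong : S.StrongPrivateBeliefs c) :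
    ∃ ε : ℝ, 0 < ε ∧ ∀ θ y, ε ≤ (S.signalLaw θ).real (S.extremeSignals c y) := by
  have hp : ∀ θ y, 0 < (S.signalLaw θ).real (S.extremeSignals c y) := fun θ y =>
    S.signalLaw_pos θ (S.isOpen_extremeSignals y)
      (StrongPrivateBeliefs.nonempty_extremeSignals S hstrong y) Set.inter_subset_left
  obtain ⟨p, hmin⟩ := Finite.exists_min
    fun p : Fin 2 × Fin 2 => (S.signalLaw p.1).real (S.extremeSignals c p.2)
  exact ⟨_, hp p.1 p.2, fun θ y => hmin (θ, y)⟩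

end SignalStructure

namespace StrategyProfile
variable {K : ℕ → ℕ} {σ : StrategyProfile K} {S : SignalStructure} {c : ℝ}

/-- Predecessors with extreme signals produce any observed history in either state. -/
lemma IsPerfectBayesian.pow_le_historyProb (hσ : σ.IsPerfectBayesian S c) (hc : c < 1 / 2)
    {ε : ℝ} (hε : 0 ≤ ε) (hext : ∀ θ y, ε ≤ (S.signalLaw θ).real (S.extremeSignals c y))
    (θ : Fin 2) (B : Finset ℕ) (h : B → Fin 2) : ε ^ B.card ≤ σ.historyProb S θ B h := by
  let A : ℕ → Set ℝ := fun m => if hm : m ∈ B then S.extremeSignals c (h ⟨m, hm⟩) else Set.univ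
  have hA : ∀ m ∈ B, MeasurableSet (A m) := by
    intro m hm
    simp only [A, hm, dite_true]
    exact (S.isOpen_extremeSignals _).measurableSet
  have hpi := Measure.infinitePi_pi (fun _ : ℕ => S.signalLaw θ) hA
  have hprod : (S.signalsLaw θ).real ((B : Set ℕ).pi A) = ∏ m ∈ B, (S.signalLaw θ).real (A m) := by
    rw [SignalStructure.signalsLaw, Measure.real, hpi, ENNReal.toReal_prod]
    rfl
  have hsub : (B : Set ℕ).pi A ⊆ {x | ∀ m : B, σ.action x m.1 = h m} := by
    intro x hx m
    have hxm := hx m.1 m.2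
    simp only [A, m.2, dite_true] at hxm
    rw [action_eq]
    exact hσ.act_of_lt_belief hc hxm.1 hxm.2 _
  refine le_trans ?_ ((hprod.symm.le).trans (measureReal_mono hsub))
  rw [← Finset.prod_const]
  refine Finset.prod_le_prod (fun _ _ => hε) fun m hm => ?_
  simp only [A, hm, dite_true]
  exact hext _ _

theorem IsPerfectBayesian.not_maximalLearning (hσ : σ.IsPerfectBayesian S c) (hc0 : 0 < c)
    (hc : c < 1 / 2) (hstrong : S.StrongPrivateBeliefs c) (hK : ¬ InfiniteObservations K) :
    ¬ σ.MaximalLearning S c := by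
  obtain ⟨ε, hε, hext⟩ := SignalStructure.StrongPrivateBeliefs.exists_extreme_prob S hstrong
  have hε1 : ε ≤ 1 := (hext 0 0).trans measureReal_le_one
  rw [InfiniteObservations, tendsto_atTop] at hK
  push Not at hK
  obtain ⟨M, hM⟩ := hK
  let mid : Set ℝ := signalSpace ∩ {s | max (S.belief 0 s) (S.belief 1 s) < 1 - c}
  have hmo : IsOpen mid :=
    ((S.continuousOn_belief 0).sup (S.continuousOn_belief 1)).isOpen_inter_preimage
      isOpen_Ioo isOpen_Iio
  have h0mem : (0 : ℝ) ∈ signalSpace := ⟨by norm_num, by norm_num⟩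
  have hmn : mid.Nonempty := by
    refine ⟨0, h0mem, ?_⟩
    have h1 := S.belief_one_neg h0mem
    rw [neg_zero] at h1
    have h2 := S.belief_add h0mem
    rw [Set.mem_ofPred_eq, max_lt_iff]
    constructor <;> linarith
  -- On `mid` both beliefs exceed `c`, and each history of fewer than `M` actions has probability at
  -- least `ε ^ M` in both states; hence this lower bound for the error.
  set loss : ℝ → ℝ := mid.indicator fun _ => c * ε ^ M with hloss
  have hlm : Measurable loss := measurable_const.indicator hmo.measurableSet
  have hl0 : ∀ s, 0 ≤ loss s := fun s =>
    Set.indicator_nonneg (fun _ _ => by positivity) s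
  have hlint : IntegrableOn (fun s => (S.f 0 s + S.f 1 s) / 2 * loss s) signalSpace := by
    refine S.integrableOn_mass_mul (C := c * ε ^ M) hlm.aestronglyMeasurable fun s => ?_
    rw [abs_of_nonneg (hl0 s)]
    exact Set.indicator_le_self' (fun _ _ => by positivity) s
  have hlpos : 0 < ∫ s in signalSpace, (S.f 0 s + S.f 1 s) / 2 * loss s := by
    rw [setIntegral_pos_iff_support_of_nonneg_ae _ hlint]
    · refine (hmo.measure_pos volume hmn).trans_le (measure_mono fun s hs => ⟨?_, hs.1⟩)
      have := add_pos (S.f_pos 0 s hs.1) (S.f_pos 1 s hs.1)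
      rw [Function.mem_support, hloss, Set.indicator_of_mem hs]
      positivity
    · filter_upwards [ae_restrict_mem SignalStructure.measurableSet_signalSpace] with s hs
      have := add_pos (S.f_pos 0 s hs) (S.f_pos 1 s hs)
      exact mul_nonneg (by linarith) (hl0 s)
  have hbound : ∀ n, K n < M → σ.learningProb S n ≤
      S.benchmark c - ∫ s in signalSpace, (S.f 0 s + S.f 1 s) / 2 * loss s := by
    intro n hn
    rw [(σ.learningProb_eq_integral S n).2, S.benchmark_eq,
      ← integral_sub (S.integrableOn_benchmark c) hlint]
    refine integral_mono_ae (σ.learningProb_eq_integral S n).1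
      ((S.integrableOn_benchmark c).sub hlint) ?_
    filter_upwards [ae_restrict_mem SignalStructure.measurableSet_signalSpace,
      S.ae_max_belief_ne c] with s hs hne
    have hmass := add_pos (S.f_pos 0 s hs) (S.f_pos 1 s hs)
    rw [← mul_sub]
    refine mul_le_mul_of_nonneg_left ?_ (by linarith)
    rw [SignalStructure.benchmarkProb]
    rcases lt_or_gt_of_ne hne with hlt | hgt
    · have hsm : s ∈ mid := ⟨hs, hlt⟩
      rw [if_pos hlt, hloss, Set.indicator_of_mem hsm]
      refine (σ.correctProb_le S hs _).trans (sub_le_sub_left ?_ 1)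
      have hadd := S.belief_add hs
      rw [max_lt_iff] at hlt
      have hH : ∀ θ h, ε ^ M ≤ σ.historyProb S θ (σ.nbhd n s) h := fun θ h =>
        (pow_le_pow_of_le_one hε.le hε1 ((σ.feasible n s).2.trans hn.le)).trans
          (hσ.pow_le_historyProb hc hε.le hext θ _ h)
      rw [bayesError]
      -- A single history, here the constant `0`, already causes enough error.
      refine le_trans ?_ (Finset.single_le_sum (f := fun h : σ.nbhd n s → Fin 2 =>
        min (S.belief 0 s * σ.historyProb S 0 (σ.nbhd n s) h)
          (S.belief 1 s * σ.historyProb S 1 (σ.nbhd n s) h)) (fun h _ => ?_)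
          (Finset.mem_univ fun _ => 0))
      · exact le_min (mul_le_mul (by linarith) (hH 0 _) (by positivity) (S.belief_pos 0 hs).le)
          (mul_le_mul (by linarith) (hH 1 _) (by positivity) (S.belief_pos 1 hs).le)
      · exact le_min (mul_nonneg (S.belief_pos 0 hs).le (σ.historyProb_nonneg S 0 _ h))
          (mul_nonneg (S.belief_pos 1 hs).le (σ.historyProb_nonneg S 1 _ h))
    · have hsm : s ∉ mid := fun h => hgt.not_gt h.2
      rw [if_neg hgt.not_gt, hloss, Set.indicator_of_notMem hsm, sub_zero,
        hσ.correctProb_of_nbhd_empty hs (hσ.nbhd_eq_empty hs hgt)]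
  intro hlearn
  have hev := hlearn.eventually_const_lt (sub_lt_self _ hlpos)
  obtain ⟨n, hn, hn2⟩ := (hM.and_eventually hev).exists
  linarith [hbound n hn]

end StrategyProfile
-- Existence of a symmetric equilibrium.
namespace SignalStructure
variable (S : SignalStructure)

/-- The density of the signal, set to `0` outside of the signal space. -/
noncomputable def density (θ : Fin 2) : ℝ → ℝ := signalSpace.indicator (S.f θ)

lemma density_of_mem (θ : Fin 2) {s : ℝ} (hs : s ∈ signalSpace) : S.density θ s = S.f θ s :=
  Set.indicator_of_mem hs _

lemma measurable_density (θ : Fin 2) : Measurable (S.density θ) := S.measurable_indicator_f θ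

lemma density_one_neg (s : ℝ) : S.density 1 (-s) = S.density 0 s := by
  by_cases hs : s ∈ signalSpace
  · rw [S.density_of_mem 0 hs, S.density_of_mem 1 (neg_mem_signalSpace hs), S.f_zero_eq hs]
  · have : -s ∉ signalSpace := fun h => hs (by simpa using neg_mem_signalSpace h)
    rw [density, density, Set.indicator_of_notMem hs, Set.indicator_of_notMem this]

lemma density_zero_neg (s : ℝ) : S.density 0 (-s) = S.density 1 s := by
  rw [← S.density_one_neg, neg_neg]

lemma map_neg_signalLaw : (S.signalLaw 0).map (fun s => -s) = S.signalLaw 1 := by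
  refine Measure.ext fun A hA => ?_
  have hpre : MeasurableSet ((fun s : ℝ => -s) ⁻¹' A) := measurable_neg hA
  rw [Measure.map_apply measurable_neg hA, ← measureReal_eq_measureReal_iff,
    S.signalLaw_real 0 hpre, S.signalLaw_real 1 hA, ← integral_signalSpace_neg]
  refine setIntegral_congr_fun measurableSet_signalSpace fun s hs => ?_
  have : ((fun s : ℝ => -s) ⁻¹' A).indicator (1 : ℝ → ℝ) (-s) = A.indicator 1 s := by
    change A.indicator 1 (- -s) = A.indicator 1 s
    rw [neg_neg]
  simp only [← S.symm s hs, this]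

lemma map_neg_signalsLaw : (S.signalsLaw 0).map (fun x n => -x n) = S.signalsLaw 1 := by
  rw [signalsLaw, Measure.infinitePi_map_pi _ (fun _ => measurable_neg)]
  simp_rw [S.map_neg_signalLaw]
  rfl

/-- At the signal `0` tie-breaking by sign is not antisymmetric; such paths are negligible. -/
lemma ae_signalsLaw (θ : Fin 2) : ∀ᵐ x ∂S.signalsLaw θ, ∀ n, x n ≠ 0 := by
  rw [ae_all_iff]
  intro n
  have h : ∀ᵐ s ∂S.signalLaw θ, s ≠ 0 := by
    have : ∀ᵐ s ∂volume.restrict signalSpace, s ≠ (0 : ℝ) := by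
      refine ae_restrict_of_ae ?_
      exact Measure.ae_ne volume 0
    exact (withDensity_absolutelyContinuous _ _).ae_le this
  rw [← S.map_eval_signalsLaw θ n] at h
  exact ae_of_ae_map (measurable_pi_apply n).aemeasurable h

end SignalStructure

namespace StrategyProfile
variable {K : ℕ → ℕ} (σ : StrategyProfile K) (S : SignalStructure) (c : ℝ)

/-- An optimal action, with ties broken by the sign of the signal. -/
noncomputable def bestAct (s : ℝ) (B : Finset ℕ) (h : B → Fin 2) : Fin 2 :=
  open Classical in
  if S.density 0 s * σ.historyProb S 0 B h < S.density 1 s * σ.historyProb S 1 B h ∨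
    (S.density 0 s * σ.historyProb S 0 B h = S.density 1 s * σ.historyProb S 1 B h ∧ 0 ≤ s)
  then 1 else 0

/-- The expected payoff from observing `B` and acting optimally, up to an affine transformation. -/
noncomputable def utility (s : ℝ) (B : Finset ℕ) : ℝ :=
  -((S.density 0 s + S.density 1 s) * if B = ∅ then 0 else c) -
    ∑ h : B → Fin 2, min (S.density 0 s * σ.historyProb S 0 B h)
      (S.density 1 s * σ.historyProb S 1 B h)

/-- The neighborhoods that agent `n` may choose. -/
def choices (K : ℕ → ℕ) (n : ℕ) : Finset (Finset ℕ) :=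
  (Finset.range n).powerset.filter fun B => B.card ≤ K n

lemma mem_choices {n : ℕ} {B : Finset ℕ} : B ∈ choices K n ↔ Feasible K n B := by
  simp [choices, Feasible]

/-- The optimal neighborhoods of agent `n` with signal `s`. -/
noncomputable def bestNbhds (n : ℕ) (s : ℝ) : Finset (Finset ℕ) :=
  open Classical in
  (choices K n).filter fun B => ∀ B' ∈ choices K n, σ.utility S c s B' ≤ σ.utility S c s B

/-- A fixed selection from nonempty sets of neighborhoods. -/
noncomputable def select (M : Finset (Finset ℕ)) : Finset ℕ :=
  open Classical in if h : M.Nonempty then h.choose else ∅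

lemma select_mem {M : Finset (Finset ℕ)} (h : M.Nonempty) : select M ∈ M := by
  rw [select, dif_pos h]; exact h.choose_spec

lemma bestNbhds_nonempty (n : ℕ) (s : ℝ) : (σ.bestNbhds S c n s).Nonempty := by
  obtain ⟨B, hB, hmax⟩ := (choices K n).exists_max_image (σ.utility S c s)
    ⟨∅, mem_choices.mpr (feasible_empty n)⟩
  exact ⟨B, by simp only [bestNbhds, Finset.mem_filter]; exact ⟨hB, hmax⟩⟩

lemma select_bestNbhds (n : ℕ) (s : ℝ) :
    Feasible K n (select (σ.bestNbhds S c n s)) ∧ ∀ B, Feasible K n B →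
      σ.utility S c s B ≤ σ.utility S c s (select (σ.bestNbhds S c n s)) := by
  have h := select_mem (σ.bestNbhds_nonempty S c n s)
  rw [bestNbhds, Finset.mem_filter] at h
  exact ⟨mem_choices.mp h.1, fun B hB => h.2 B (mem_choices.mpr hB)⟩

lemma measurable_utility (B : Finset ℕ) : Measurable fun s => σ.utility S c s B := by
  have h0 := S.measurable_density 0
  have h1 := S.measurable_density 1
  unfold utility
  refine (((h0.add h1).mul_const _).neg).sub (Finset.measurable_sum _ fun h _ => ?_)
  exact (h0.mul_const _).min (h1.mul_const _)

/-- The selection may be arbitrary: it depends on `s` only through `bestNbhds`, which takes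
countably many values on measurable sets. -/
lemma measurableSet_select_bestNbhds (n : ℕ) (B : Finset ℕ) :
    MeasurableSet {s | select (σ.bestNbhds S c n s) = B} := by
  have hmem : ∀ B', MeasurableSet {s | B' ∈ σ.bestNbhds S c n s} := by
    intro B'
    simp only [bestNbhds, Finset.mem_filter]
    refine (MeasurableSet.const _).inter ?_
    refine MeasurableSet.congr (.iInter fun B'' => .iInter fun _ : B'' ∈ choices K n =>
      measurableSet_le (σ.measurable_utility S c B'') (σ.measurable_utility S c B')) ?_
    ext s
    simp only [Set.mem_iInter]
    rfl
  have : {s | select (σ.bestNbhds S c n s) = B} =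
      ⋃ M : Finset (Finset ℕ), ⋃ _ : select M = B,
        ⋂ B', {s | B' ∈ σ.bestNbhds S c n s ↔ B' ∈ M} := by
    ext s
    simp only [Set.mem_ofPred_eq, Set.mem_iUnion, Set.mem_iInter]
    constructor
    · exact fun h => ⟨_, h, fun _ => Iff.rfl⟩
    · rintro ⟨M, hM, h⟩
      rw [Finset.ext h, hM]
  rw [this]
  refine .iUnion fun M => .iUnion fun _ => .iInter fun B' => ?_
  by_cases hB : B' ∈ M
  · simpa only [hB, iff_true] using hmem B'
  · simp only [hB, iff_false]
    exact (hmem B').compl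

lemma measurable_bestAct (B : Finset ℕ) (h : B → Fin 2) :
    Measurable fun s => σ.bestAct S s B h := by
  have h0 := (S.measurable_density 0).mul_const (σ.historyProb S 0 B h)
  have h1 := (S.measurable_density 1).mul_const (σ.historyProb S 1 B h)
  unfold bestAct
  refine Measurable.ite ?_ measurable_const measurable_const
  exact (measurableSet_lt h0 h1).union ((measurableSet_eq_fun h0 h1).inter measurableSet_Ici)

/-- All agents respond optimally to the profile `σ`. -/
noncomputable def respond : StrategyProfile K where
  nbhd n s := select (σ.bestNbhds S c n s)
  -- The default `0` makes `act n` depend on the predecessors of `n` alone, as `respond_congr`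
  -- requires for all `B`.
  act n s B h := if B ⊆ Finset.range n then σ.bestAct S s B h else 0
  feasible n s := (σ.select_bestNbhds S c n s).1
  measurableSet_nbhd n B := σ.measurableSet_select_bestNbhds S c n B
  measurable_act n B h := by
    split_ifs
    · exact σ.measurable_bestAct S B h
    · exact measurable_const

/-- The profile in which nobody observes and everybody chooses `0`. -/
def passive (K : ℕ → ℕ) : StrategyProfile K where
  nbhd _ _ := ∅
  act _ _ _ _ := 0
  feasible n _ := feasible_empty n
  measurableSet_nbhd _ _ := MeasurableSet.const _
  measurable_act _ _ _ := measurable_const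

variable {σ} in
lemma historyProb_congr {τ : StrategyProfile K} {n : ℕ} (hn : ∀ m < n, σ.nbhd m = τ.nbhd m)
    (ha : ∀ m < n, σ.act m = τ.act m) (θ : Fin 2) {B : Finset ℕ} (hB : B ⊆ Finset.range n)
    (h : B → Fin 2) : σ.historyProb S θ B h = τ.historyProb S θ B h := by
  rw [historyProb, historyProb]
  congr 1
  ext x
  refine forall_congr' fun m => ?_
  have hm := Finset.mem_range.mp (hB m.2)
  rw [action_congr (σ := σ) (τ := τ) (fun _ _ => rfl) (fun k hk => hn k (hk.trans_lt hm))
    (fun k hk => ha k (hk.trans_lt hm))]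

variable {σ} in
lemma respond_congr {τ : StrategyProfile K} {n : ℕ} (hn : ∀ m < n, σ.nbhd m = τ.nbhd m)
    (ha : ∀ m < n, σ.act m = τ.act m) :
    (σ.respond S c).nbhd n = (τ.respond S c).nbhd n ∧
      (σ.respond S c).act n = (τ.respond S c).act n := by
  have hu : ∀ s, ∀ B ∈ choices K n, σ.utility S c s B = τ.utility S c s B := by
    intro s B hB
    simp only [utility, historyProb_congr S hn ha _ (mem_choices.mp hB).1]
  constructor
  · funext s
    have : σ.bestNbhds S c n s = τ.bestNbhds S c n s := by
      rw [bestNbhds, bestNbhds]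
      refine Finset.filter_congr fun B hB => forall₂_congr fun B' hB' => ?_
      rw [hu s B hB, hu s B' hB']
    exact congrArg select this
  · funext s B h
    simp only [respond]
    split_ifs with hB
    · simp only [bestAct, historyProb_congr S hn ha _ hB]
    · rfl

/-- The first `n` agents of the `n`-th iterate respond optimally. -/
noncomputable def iterate (K : ℕ → ℕ) (n : ℕ) : StrategyProfile K :=
  (fun σ => σ.respond S c)^[n] (passive K)

lemma iterate_succ (n : ℕ) : iterate S c K (n + 1) = (iterate S c K n).respond S c :=
  Function.iterate_succ_apply' _ _ _

/-- A response depends only on predecessors, so each iteration settles one more agent. -/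
lemma iterate_stable (n : ℕ) : ∀ m < n,
    (iterate S c K (n + 1)).nbhd m = (iterate S c K n).nbhd m ∧
      (iterate S c K (n + 1)).act m = (iterate S c K n).act m := by
  induction n with
  | zero => intro m hm; omega
  | succ n ih =>
    intro m hm
    rw [iterate_succ S c (n + 1)]
    nth_rw 2 [iterate_succ S c n]
    nth_rw 3 [iterate_succ S c n]
    exact respond_congr S c (fun k hk => (ih k (by omega)).1) (fun k hk => (ih k (by omega)).2)

lemma iterate_stable_le {m n : ℕ} (h : m < n) :
    (iterate S c K n).nbhd m = (iterate S c K (m + 1)).nbhd m ∧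
      (iterate S c K n).act m = (iterate S c K (m + 1)).act m := by
  induction n, (show m + 1 ≤ n from h) using Nat.le_induction with
  | base => exact ⟨rfl, rfl⟩
  | succ n hn ih =>
    have h1 := iterate_stable (K := K) S c n m hn
    exact ⟨h1.1.trans (ih hn).1, h1.2.trans (ih hn).2⟩

/-- The profile in which every agent responds optimally to her predecessors. -/
noncomputable def equilibrium (K : ℕ → ℕ) : StrategyProfile K where
  nbhd n := (iterate S c K (n + 1)).nbhd n
  act n := (iterate S c K (n + 1)).act n
  feasible n := (iterate S c K (n + 1)).feasible n
  measurableSet_nbhd n := (iterate S c K (n + 1)).measurableSet_nbhd n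
  measurable_act n := (iterate S c K (n + 1)).measurable_act n

/-- Below `n` the limit profile agrees with the `n`-th iterate, hence so do the responses of agent
`n`; her strategy in the limit is her response to that iterate. -/
lemma equilibrium_eq_respond (n : ℕ) :
    (equilibrium S c K).nbhd n = ((equilibrium S c K).respond S c).nbhd n ∧
      (equilibrium S c K).act n = ((equilibrium S c K).respond S c).act n := by
  have h := respond_congr (σ := iterate S c K n) (τ := equilibrium S c K) (n := n) S c
    (fun m hm => (iterate_stable_le S c hm).1) (fun m hm => (iterate_stable_le S c hm).2)
  rw [← iterate_succ] at h
  exact h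

variable {σ S c}

lemma likelihood_le_of_respond (ha : ∀ n, σ.act n = (σ.respond S c).act n) {n : ℕ} {s : ℝ}
    (hs : s ∈ signalSpace) {B : Finset ℕ} (hB : B ⊆ Finset.range n) (h : B → Fin 2) (y : Fin 2) :
    S.f y s * σ.historyProb S y B h ≤
      S.f (σ.act n s B h) s * σ.historyProb S (σ.act n s B h) B h := by
  have hact : σ.act n s B h = σ.bestAct S s B h := by
    rw [ha]; simp only [respond, if_pos hB]
  rw [hact, bestAct, S.density_of_mem 0 hs, S.density_of_mem 1 hs]
  split_ifs with hif
  · have : S.f 0 s * σ.historyProb S 0 B h ≤ S.f 1 s * σ.historyProb S 1 B h := by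
      rcases hif with hif | hif
      · exact hif.le
      · exact hif.1.le
    fin_cases y
    · exact this
    · exact le_rfl
  · have : S.f 1 s * σ.historyProb S 1 B h ≤ S.f 0 s * σ.historyProb S 0 B h := by
      by_contra hlt
      exact hif (Or.inl (not_le.mp hlt))
    fin_cases y
    · exact le_rfl
    · exact this

/-- The factor is positive and does not depend on `B`, so both functions have the same maximizers.
-/
lemma utility_eq_of_respond (ha : ∀ n, σ.act n = (σ.respond S c).act n) {n : ℕ} {s : ℝ}
    (hs : s ∈ signalSpace) {B : Finset ℕ} (hB : B ⊆ Finset.range n) :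
    σ.utility S c s B = (S.f 0 s + S.f 1 s) * (σ.expectedPayoff S c n s B - 1) := by
  have hpos := add_pos (S.f_pos 0 s hs) (S.f_pos 1 s hs)
  rw [expectedPayoff_eq, correctProb_eq_of_likelihood hs fun h y =>
    likelihood_le_of_respond ha hs hB h y, utility, bayesError, S.density_of_mem 0 hs,
    S.density_of_mem 1 hs]
  have : ∑ h : B → Fin 2, min (S.f 0 s * σ.historyProb S 0 B h) (S.f 1 s * σ.historyProb S 1 B h) =
      (S.f 0 s + S.f 1 s) * ∑ h : B → Fin 2, min (S.belief 0 s * σ.historyProb S 0 B h)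
        (S.belief 1 s * σ.historyProb S 1 B h) := by
    rw [Finset.mul_sum]
    refine Finset.sum_congr rfl fun h _ => ?_
    rw [mul_min_of_nonneg _ _ hpos.le, ← mul_assoc, ← mul_assoc, S.mass_mul_belief 0 hs,
      S.mass_mul_belief 1 hs]
  rw [this]
  ring

lemma isPerfectBayesian_of_respond (hn : ∀ n, σ.nbhd n = (σ.respond S c).nbhd n)
    (ha : ∀ n, σ.act n = (σ.respond S c).act n) : σ.IsPerfectBayesian S c where
  act_optimal n s hs B hB h y := by
    refine div_le_div_of_nonneg_right (likelihood_le_of_respond ha hs hB.1 h y) ?_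
    exact add_nonneg (mul_nonneg (S.f_pos 0 s hs).le (σ.historyProb_nonneg S 0 B h))
      (mul_nonneg (S.f_pos 1 s hs).le (σ.historyProb_nonneg S 1 B h))
  nbhd_optimal n s hs B hB := by
    have h := (σ.select_bestNbhds S c n s).2 B hB
    have hnb : σ.nbhd n s = select (σ.bestNbhds S c n s) := by rw [hn]; rfl
    rw [← hnb, utility_eq_of_respond ha hs hB.1,
      utility_eq_of_respond ha hs (σ.feasible n s).1] at h
    linarith [le_of_mul_le_mul_left h (add_pos (S.f_pos 0 s hs) (S.f_pos 1 s hs))]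

/-- Reflecting all signals carries the law in state `0` to that in state `1` and, almost surely,
flips the actions. -/
lemma historyProb_flip {n : ℕ} (hflip : ∀ m < n, ∀ x : ℕ → ℝ, (∀ k, x k ≠ 0) →
      σ.action (fun k => -x k) m = 1 - σ.action x m) {B : Finset ℕ} (hB : B ⊆ Finset.range n)
    (h : B → Fin 2) :
    σ.historyProb S 1 B (fun m => 1 - h m) = σ.historyProb S 0 B h := by
  have hm : MeasurableSet {x : ℕ → ℝ | ∀ m : B, σ.action x m.1 = 1 - h m} := by
    simp only [Set.ofPred_forall]
    exact .iInter fun m => σ.measurable_action m.1 (measurableSet_singleton (1 - h m))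
  have hneg : Measurable fun (x : ℕ → ℝ) (n : ℕ) => -x n :=
    measurable_pi_lambda _ fun n => (measurable_pi_apply n).neg
  rw [historyProb, historyProb, ← S.map_neg_signalsLaw, map_measureReal_apply hneg hm]
  refine measureReal_congr ?_
  filter_upwards [S.ae_signalsLaw 0] with x hx
  refine propext (forall_congr' fun m => ?_)
  rw [hflip m.1 (Finset.mem_range.mp (hB m.2)) x hx, sub_right_inj]

/-- Reflection swaps the two terms of each minimum after relabeling histories, so the utility is
even. The set of optima is then even, and so is any selection from it. -/
lemma bestNbhds_neg {n : ℕ} (hflip : ∀ (B : Finset ℕ), B ⊆ Finset.range n → ∀ h : B → Fin 2,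
      σ.historyProb S 1 B (fun m => 1 - h m) = σ.historyProb S 0 B h) (s : ℝ) :
    σ.bestNbhds S c n (-s) = σ.bestNbhds S c n s := by
  have hu : ∀ B ∈ choices K n, σ.utility S c (-s) B = σ.utility S c s B := by
    intro B hB
    have hf := hflip B (mem_choices.mp hB).1
    rw [utility, utility, S.density_zero_neg, S.density_one_neg, add_comm (S.density 1 s)]
    congr 1
    rw [← (Equiv.subLeft (1 : B → Fin 2)).sum_comp]
    refine Finset.sum_congr rfl fun h _ => ?_
    have e1 : σ.historyProb S 1 B (Equiv.subLeft (1 : B → Fin 2) h) = σ.historyProb S 0 B h := hf h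
    have e0 : σ.historyProb S 0 B (Equiv.subLeft (1 : B → Fin 2) h) = σ.historyProb S 1 B h := by
      rw [← hf]
      congr 1
      funext m
      simp
    rw [e1, e0, min_comm]
  rw [bestNbhds, bestNbhds]
  refine Finset.filter_congr fun B hB => forall₂_congr fun B' hB' => ?_
  rw [hu B hB, hu B' hB']

lemma bestAct_neg {s : ℝ} (hs : s ≠ 0) {B : Finset ℕ} (hflip : ∀ h : B → Fin 2,
      σ.historyProb S 1 B (fun m => 1 - h m) = σ.historyProb S 0 B h) (h : B → Fin 2) :
    σ.bestAct S (-s) B (fun m => 1 - h m) = 1 - σ.bestAct S s B h := by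
  have e0 : σ.historyProb S 0 B (fun m => 1 - h m) = σ.historyProb S 1 B h := by
    rw [← hflip]
    congr 1
    funext m
    simp
  rw [bestAct, bestAct, hflip, e0, S.density_zero_neg, S.density_one_neg]
  rcases lt_trichotomy (S.density 0 s * σ.historyProb S 0 B h)
    (S.density 1 s * σ.historyProb S 1 B h) with hlt | heq | hgt
  · simp [hlt, hlt.not_gt, hlt.ne']
  -- Only in a tie does the sign of the signal decide, and then oppositely at `s` and `-s`.
  · rcases lt_or_gt_of_ne hs with h1 | h1
    · simp [heq, h1.le, h1.not_ge]
    · simp [heq, h1.le, h1.not_ge]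
  · simp [hgt, hgt.not_gt, hgt.ne']

/-- The induction runs in a loop: flipped actions of predecessors give flipped history
probabilities, hence an even neighborhood and a flipped action of `n`. -/
lemma action_neg_of_respond (hn : ∀ n, σ.nbhd n = (σ.respond S c).nbhd n)
    (ha : ∀ n, σ.act n = (σ.respond S c).act n) (n : ℕ) : ∀ x : ℕ → ℝ, (∀ k, x k ≠ 0) →
      σ.action (fun k => -x k) n = 1 - σ.action x n := by
  induction n using Nat.strong_induction_on with
  | _ n ih =>
    intro x hx
    have hflip : ∀ (B : Finset ℕ), B ⊆ Finset.range n → ∀ h : B → Fin 2,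
        σ.historyProb S 1 B (fun m => 1 - h m) = σ.historyProb S 0 B h :=
      fun B hB h => historyProb_flip ih hB h
    have hnb : σ.nbhd n (-x n) = σ.nbhd n (x n) := by
      rw [hn]
      exact congrArg select (bestNbhds_neg hflip (x n))
    have hB := (σ.feasible n (x n)).1
    rw [action_eq, action_eq]
    have hact : (fun m : σ.nbhd n (x n) => σ.action (fun k => -x k) m.1) =
        fun m => 1 - σ.action x m.1 := by
      funext m
      exact ih m.1 (σ.lt_of_mem_nbhd m) x hx
    have hbest : ∀ s h, σ.act n s (σ.nbhd n (x n)) h = σ.bestAct S s (σ.nbhd n (x n)) h := by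
      intro s h
      rw [ha]
      simp only [respond]
      exact if_pos hB
    rw [hnb, hact, hbest, hbest]
    exact bestAct_neg (hx n) (hflip _ hB) _

theorem isSymmetricEquilibrium_equilibrium (S : SignalStructure) (c : ℝ) (K : ℕ → ℕ) :
    (equilibrium S c K).IsSymmetricEquilibrium S c := by
  have hn := fun n => (equilibrium_eq_respond (K := K) S c n).1
  have ha := fun n => (equilibrium_eq_respond (K := K) S c n).2
  refine ⟨isPerfectBayesian_of_respond hn ha, fun n s _ => ?_⟩
  rw [hn]
  exact congrArg select (bestNbhds_neg (fun B hB h => historyProb_flip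
    (fun m _ => action_neg_of_respond hn ha m) hB h) s).symm

end StrategyProfile
end CostlyLearning

theorem theorem2 (S : CostlyLearning.SignalStructure) (c : ℝ) (hc : 0 < c) (hc' : c < 1 / 2)
    (hstrong : S.StrongPrivateBeliefs c)
    (K : ℕ → ℕ) (hK : ∃ N : ℕ, ∀ n > N, 0 < K n) :
    (∀ σ : CostlyLearning.StrategyProfile K,
        σ.IsSymmetricEquilibrium S c → σ.MaximalLearning S c) ↔
      CostlyLearning.InfiniteObservations K := by
  refine ⟨fun h => ?_, fun h σ hσ => hσ.maximalLearning hc.le hc' hstrong h⟩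
  by_contra hK'
  -- Existence keeps the assumption about all equilibria from being vacuous.
  have heq := CostlyLearning.StrategyProfile.isSymmetricEquilibrium_equilibrium S c K
  exact heq.1.not_maximalLearning hc hc' hstrong hK' (h _ heq)
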